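/- **Setting.** Let $Y_1,\dots,Y_{n+1}$ be $\{0,1\}$-valued random variables (value $1$ is a "failure") with a joint law $Q$ in the set $\mathcal Q_{n+1}$ of permutation invariant laws on $\{0,1\}^{n+1}$. For $0\le\lambda<1$ put $\nu=1-\lambda$, and let $U_1,\dots,U_n$ be conditionally independent given $Y$, with $U_i=0$ if $Y_i=0$, and $U_i=0$ with probability $\lambda$, $U_i=1$ with probability $1-\lambda$ if $Y_i=1$. Let $L=\sum_{i\le n}U_i$ and $K=\sum_{i\le n}Y_i$. For integers $k,l\ge0$, $n\ge 1$ and $0<\delta<1$ define the upper confidence limits $$\overline\epsilon_\lambda(l,n,\delta)=\max_{Q\in\mathcal Q_{n+1}}\{Q(Y_{n+1}=1\mid L\le l) : Q(L\le l)\ge\delta\},$$ $$\overline\epsilon_{\rm iid}(k,n,\delta)=\max_{Q\ \text{iid}}\{Q(Y_{n+1}=1\mid K\le k) : Q(K\le k)\ge\delta\},$$ where "iid" means that $Q$ is the law of $n+1$ independent $\{0,1\}$-valued variables, each equal to $1$ with the same probability $\theta\in[0,1]$. (For $\lambda=0$ one has $L=K$: the deterministic test.) For $0<\epsilon<1$ define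 the minimum numbers of observations $$N_\lambda(l,\epsilon,\delta)=\min\{n\ge l+1:\overline\epsilon_\lambda(l,n,\delta)\le\epsilon\},\qquad N_{\rm iid}(k,\epsilon,\delta)=\min\{n\ge k+1:\overline\epsilon_{\rm iid}(k,n,\delta)\le\epsilon\}.$$ Let $B_{z,l}=\sum_{j=0}^{l}\binom zj\nu^j(1-\nu)^{z-j}$, $z^*=\min\{z\ge l: B_{z,l}\le\delta\}$, $z_*=z^*-1$, and $$G(l,\delta,\lambda)=\frac{(B_{z_*,l}-\delta)\,z^*B_{z_*,l}+(\delta-B_{z^*,l})\,z_*B_{z_*-1,l}}{\delta\,(B_{z_*,l}-B_{z_*+1,l})}$$ (the term with factor $z_*$ is $0$ when $z_*=0$). Let $t_{\rm P}(k,\delta)$ be the unique $t\ge0$ with $e^{-t}\sum_{j=0}^k t^j/j!=\delta$. **Corollary.** Let $0<\lambda<1$ and let $k_0\ge0$ be an integer. (a) For every fixed $0<\delta<1$, as $\epsilon\to0^+$, $$N_0(k_0,\epsilon,\delta)=\frac{k_0+1-\delta}{\delta\epsilon}+o(\epsilon^{-1}),\quad N_\lambda(\lceil\nu k_0\rceil,\epsilon,\delta)=\frac{G(\lceil\nu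 k_0\rceil,\delta,\lambda)}{\epsilon}+o(\epsilon^{-1}),\quad N_{\rm iid}(k_0,\epsilon,\delta)=\frac{t_{\rm P}(k_0,\delta)}{\epsilon}+o(\epsilon^{-1}).$$ (b) For every fixed $0<\epsilon<1$, as $\delta\to0^+$, $$N_0(k_0,\epsilon,\delta)=\frac{k_0+1}{\delta\epsilon}+o(\delta^{-1}),\quad N_\lambda(\lceil\nu k_0\rceil,\epsilon,\delta)=\frac{1-\nu\epsilon}{\lambda\epsilon\ln\lambda^{-1}}\ln\delta^{-1}+o(\ln\delta^{-1}),\quad N_{\rm iid}(k_0,\epsilon,\delta)=\frac{\ln\delta^{-1}}{\ln(1-\epsilon)^{-1}}+o(\ln\delta^{-1}).$$ In particular, randomization improves the required number of observations exponentially as $\delta\to0^+$: for every fixed $0<\epsilon<1$, $$\lim_{\delta\to0^+}\frac{\ln N_0(k_0,\epsilon,\delta)}{N_\lambda(\lceil\nu k_0\rceil,\epsilon,\delta)}=\frac{\lambda\epsilon\ln\lambda^{-1}}{1-\nu\epsilon}>0 .$$ -/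

import Mathlib

open Filter Topology Asymptotics

noncomputable section

namespace RandomizedTest

/-! Outcomes are Booleans: `true` stands for the outcome 1 (a failure) and `false` for the
outcome 0 (a success). Laws on a finite set are given by their real weights. -/

/-- The probability of the event `A` under the law on a finite set with weights `P`. -/
def prob {Ω : Type*} [Fintype Ω] (P : Ω → ℝ) (A : Set Ω) : ℝ :=
  ∑ ω, A.indicator P ω

/-- The conditional probability of `A` given `B`. -/
def condProb {Ω : Type*} [Fintype Ω] (P : Ω → ℝ) (A B : Set Ω) : ℝ :=
  prob P (A ∩ B) / prob P B

/-- The permutation invariant probability distributions of `m` binary variables. -/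
def exchangeableLaws (m : ℕ) : Set ((Fin m → Bool) → ℝ) :=
  {Q | Q ∈ stdSimplex ℝ (Fin m → Bool) ∧
    ∀ (σ : Equiv.Perm (Fin m)) (y : Fin m → Bool), Q (y ∘ σ) = Q y}

/-- The law of `m` independent binary variables, each equal to 1 with probability `θ`. -/
def iidLaw (θ : ℝ) (m : ℕ) (y : Fin m → Bool) : ℝ :=
  ∏ i, if y i then θ else 1 - θ

/-- The independent and identical distributions of `m` binary variables. -/
def iidLaws (m : ℕ) : Set ((Fin m → Bool) → ℝ) :=
  {Q | ∃ θ ∈ Set.Icc (0 : ℝ) 1, Q = iidLaw θ m}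

/-- The number of failures in a sequence of outcomes. -/
def failures {m : ℕ} (u : Fin m → Bool) : ℕ :=
  (Finset.univ.filter fun i => u i = true).card

/-- The noise with parameter `lam`: the probability of recording `u` when the observed variable
is `y`. A success is always recorded as a success, a failure is recorded as a success with
probability `lam` and as a failure with probability `1 - lam`. -/
def noise (lam : ℝ) : (y u : Bool) → ℝ
  | false, false => 1
  | false, true => 0
  | true, false => lam
  | true, true => 1 - lam

/-- The joint law of `(Y₁, …, Yₙ₊₁)` and `(U₁, …, Uₙ)`: the sequence `Y` has law `Q`, and given
`Y` the records `Uᵢ`, `i ≤ n`, are independent, `Uᵢ` being the noisy version of `Yᵢ`. -/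
def noisyLaw {n : ℕ} (lam : ℝ) (Q : (Fin (n + 1) → Bool) → ℝ)
    (ω : (Fin (n + 1) → Bool) × (Fin n → Bool)) : ℝ :=
  Q ω.1 * ∏ i : Fin n, noise lam (ω.1 i.castSucc) (ω.2 i)

/-- The upper confidence limit of the randomized test with parameter `lam`: the maximum of
`Q(Yₙ₊₁ = 1 | L ≤ l)` over permutation invariant `Q` with `Q(L ≤ l) ≥ δ`, where `L` is the number
of failures among `U₁, …, Uₙ`. For `lam = 0` one has `U = (Y₁, …, Yₙ)`, and this is the
deterministic test. -/
def upperLimit (lam : ℝ) (l n : ℕ) (δ : ℝ) : ℝ :=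
  sSup {x | ∃ Q ∈ exchangeableLaws (n + 1),
    δ ≤ prob (noisyLaw lam Q) {ω | failures ω.2 ≤ l} ∧
    x = condProb (noisyLaw lam Q) {ω | ω.1 (Fin.last n) = true} {ω | failures ω.2 ≤ l}}

/-- The upper confidence limit in the iid setting: the maximum of `Q(Yₙ₊₁ = 1 | K ≤ k)` over
independent and identical distributions `Q` with `Q(K ≤ k) ≥ δ`, where `K` is the number of
failures among `Y₁, …, Yₙ`. -/
def upperLimitIid (k n : ℕ) (δ : ℝ) : ℝ :=
  sSup {x | ∃ Q ∈ iidLaws (n + 1),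
    δ ≤ prob Q {y | failures (fun i : Fin n => y i.castSucc) ≤ k} ∧
    x = condProb Q {y | y (Fin.last n) = true}
      {y | failures (fun i : Fin n => y i.castSucc) ≤ k}}

/-- The minimum number of observations `n ≥ l + 1` for which the upper confidence limit of the
randomized test is at most `ε` at significance level `δ`. -/
def minObs (lam : ℝ) (l : ℕ) (ε δ : ℝ) : ℕ :=
  sInf {n | l + 1 ≤ n ∧ upperLimit lam l n δ ≤ ε}

/-- The minimum number of observations `n ≥ k + 1` for which the upper confidence limit in the
iid setting is at most `ε` at significance level `δ`. -/
def minObsIid (k : ℕ) (ε δ : ℝ) : ℕ :=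
  sInf {n | k + 1 ≤ n ∧ upperLimitIid k n δ ≤ ε}

/-- The binomial distribution function `B_{z,l}(p)`. -/
def binomCDF (z l : ℕ) (p : ℝ) : ℝ :=
  ∑ j ∈ Finset.range (l + 1), (z.choose j : ℝ) * p ^ j * (1 - p) ^ (z - j)

/-- `z^*(l, δ, lam)`, the least `z ≥ l` with `B_{z,l}(1 - lam) ≤ δ`. -/
def zUpper (l : ℕ) (δ lam : ℝ) : ℕ :=
  sInf {z | l ≤ z ∧ binomCDF z l (1 - lam) ≤ δ}

/-- `z_*(l, δ, lam) = z^*(l, δ, lam) - 1`. For `δ < 1` one has `z^* ≥ l + 1`, because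
`B_{l,l} = 1`, so the subtraction does not truncate. -/
def zLower (l : ℕ) (δ lam : ℝ) : ℕ :=
  zUpper l δ lam - 1

/-- The coefficient `G(l, δ, lam)`. When `z_* = 0` the term with `B_{z_* - 1, l}` is multiplied
by `z_* = 0`. -/
def coeffG (l : ℕ) (δ lam : ℝ) : ℝ :=
  let B : ℕ → ℝ := fun z => binomCDF z l (1 - lam)
  let zu := zUpper l δ lam
  let zl := zLower l δ lam
  ((B zl - δ) * zu * B zl + (δ - B zu) * zl * B (zl - 1)) / (δ * (B zl - B (zl + 1)))

/-- The Poisson distribution function `Pois(k, x)`. -/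
def poisCDF (k : ℕ) (x : ℝ) : ℝ :=
  Real.exp (-x) * ∑ j ∈ Finset.range (k + 1), x ^ j / (j.factorial : ℝ)

/-- `t_P(k, δ)`, the solution `t ≥ 0` of `Pois(k, t) = δ`; see `poisTime_spec`. -/
def poisTime (k : ℕ) (δ : ℝ) : ℝ :=
  sInf {t | 0 ≤ t ∧ poisCDF k t = δ}

theorem hasDerivAt_poisCDF (k : ℕ) (x : ℝ) :
    HasDerivAt (poisCDF k) (-(Real.exp (-x) * (x ^ k / (k.factorial : ℝ)))) x := by
  have he : HasDerivAt (fun x : ℝ => Real.exp (-x)) (-Real.exp (-x)) x := by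
    simpa using (hasDerivAt_neg x).exp
  induction k with
  | zero =>
    have h0 : poisCDF 0 = fun x : ℝ => Real.exp (-x) := by
      funext y; simp [poisCDF]
    rw [h0]; simpa using he
  | succ k ih =>
    have h1 : poisCDF (k + 1) =
        fun y => poisCDF k y + Real.exp (-y) * (y ^ (k + 1) / ((k + 1).factorial : ℝ)) := by
      funext y
      rw [poisCDF, Finset.sum_range_succ, mul_add, ← poisCDF]
    rw [h1]
    have h2 := ih.add (he.mul ((hasDerivAt_pow (k + 1) x).div_const ((k + 1).factorial : ℝ)))
    refine h2.congr_deriv ?_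
    have hk : (k.factorial : ℝ) ≠ 0 := by positivity
    have hk' : (k : ℝ) + 1 ≠ 0 := by positivity
    rw [Nat.factorial_succ]
    push_cast
    field_simp
    ring

/-- For `0 < δ < 1`, `poisTime k δ` is the unique solution `t ≥ 0` of `Pois(k, t) = δ`. -/
theorem poisTime_spec (k : ℕ) {δ : ℝ} (h0 : 0 < δ) (h1 : δ < 1) :
    (0 ≤ poisTime k δ ∧ poisCDF k (poisTime k δ) = δ) ∧
      ∀ t, 0 ≤ t → poisCDF k t = δ → t = poisTime k δ := by
  have hcont : Continuous (poisCDF k) := by unfold poisCDF; fun_prop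
  have hanti : StrictAntiOn (poisCDF k) (Set.Ici 0) := by
    refine strictAntiOn_of_deriv_neg (convex_Ici 0) hcont.continuousOn fun x hx => ?_
    rw [interior_Ici] at hx
    have hx' : 0 < x := hx
    rw [(hasDerivAt_poisCDF k x).deriv]
    have : 0 < Real.exp (-x) * (x ^ k / (k.factorial : ℝ)) := by positivity
    linarith
  have hz : poisCDF k 0 = 1 := by
    simp [poisCDF, Finset.sum_range_succ']
  have hlim : Tendsto (poisCDF k) atTop (𝓝 0) := by
    have : poisCDF k = fun x => ∑ j ∈ Finset.range (k + 1),
        (x ^ j * Real.exp (-x)) / (j.factorial : ℝ) := by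
      funext x
      rw [poisCDF, Finset.mul_sum]
      exact Finset.sum_congr rfl fun j _ => by ring
    rw [this, show (0 : ℝ) = ∑ j ∈ Finset.range (k + 1), 0 / (j.factorial : ℝ) by simp]
    exact tendsto_finsetSum _ fun j _ =>
      (Real.tendsto_pow_mul_exp_neg_atTop_nhds_zero j).div_const _
  obtain ⟨b, hb, hb0⟩ := ((hlim.eventually (gt_mem_nhds h0)).and (eventually_ge_atTop 0)).exists
  obtain ⟨t, ht, hte⟩ := intermediate_value_Icc' hb0 hcont.continuousOn
    (show δ ∈ Set.Icc (poisCDF k b) (poisCDF k 0) from ⟨hb.le, by rw [hz]; exact h1.le⟩)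
  have hset : {t | 0 ≤ t ∧ poisCDF k t = δ} = {t} := by
    ext s
    constructor
    · rintro ⟨hs, hse⟩
      exact hanti.injOn hs ht.1 (hse.trans hte.symm)
    · rintro rfl
      exact ⟨ht.1, hte⟩
  have heq : poisTime k δ = t := by rw [poisTime, hset, csInf_singleton]
  rw [heq]
  exact ⟨⟨ht.1, hte⟩, fun s hs hse => hanti.injOn hs ht.1 (hse.trans hte.symm)⟩

end RandomizedTest

end

open RandomizedTest

/-!
By symmetrization, a permutation invariant law of `n + 1` binary variables acts as a mixture of the
laws that place `z` failures uniformly at random. Write `B z = binomCDF z l (1 - lam)`. Under the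
law with `z` failures, the last variable is a failure with probability `z / (n + 1)`, so the
probability of `L ≤ l` is `h z = z / (n + 1) * B (z - 1) + (1 - z / (n + 1)) * B z`, and that of
`L ≤ l` together with a failure of the last variable is `g z = z / (n + 1) * B (z - 1)`. The upper
confidence limit is therefore the value of a linear fractional program with the single constraint
`h ≥ δ`. A multiplier for that constraint certifies an upper bound (`upperLimit_le_of_multiplier`),
and a mixture of two numbers of failures gives a lower bound (`mix_le_of_upperLimit_le`). All
asymptotic claims follow by choosing multipliers and mixtures.

* For `lam = 0` the program is explicit, and the minimum number of observations is known up to a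
  bounded error (`minObs_zero_bounds`).
* For `0 < lam < 1` and `ε → 0`, the points `(h z, (n + 1) * g z)` tend to `(B z, z * B (z - 1))`.
  For `z ≥ l` these lie on the graph of a concave function of the abscissa `B z`: as `z` grows,
  `B z` decreases while the slope of the chord from `z` to `z + 1` increases, because it is an
  increasing linear function of `z` minus a positive multiple of `B z / b z`, where `b z` is the
  binomial weight of `l`, and that ratio decreases (`cdf_div_mass_antitone`). So the line through
  the two consecutive points whose abscissae straddle `δ` lies above all points
  (`mul_binomCDF_pred_le_chord`). Its ordinate at `δ` is `δ * coeffG`. It has positive intercept,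
  which leaves room for the passage from `n = ∞` to large `n`.
* For `0 < lam < 1` and `δ → 0`, what matters is that `B (z + 1) / B z` is at least `lam` and tends
  to `lam`. Numbers of failures up to about `lam * ε * n / (1 - (1 - lam) * ε)` satisfy
  `g z ≤ ε * h z`; at this threshold `h` is `lam ^ z` up to subexponential factors, and `n` suffices
  once that is below `δ` (`upperLimit_le_of_log_le`, `log_le_of_upperLimit_le`).
* In the iid setting the condition is `B(ε) ≤ δ` for the binomial distribution function
  (`upperLimitIid_le`, `binomCDF_le_of_upperLimitIid_le`). The claims follow from its Poisson limit
  (`tendsto_binomCDF_poisCDF`) and its exponential decay (`exists_binomCDF_le`).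
-/

namespace RandomizedTest

/-! ### Binomial probabilities -/

/-- The binomial weight `C(z, j) p ^ j (1 - p) ^ (z - j)`. -/
def binomMass (z j : ℕ) (p : ℝ) : ℝ :=
  (z.choose j : ℝ) * p ^ j * (1 - p) ^ (z - j)

theorem binomCDF_zero_right (z : ℕ) (p : ℝ) : binomCDF z 0 p = (1 - p) ^ z := by
  simp [binomCDF]

theorem binomCDF_succ_right (z l : ℕ) (p : ℝ) :
    binomCDF z (l + 1) p = binomCDF z l p + binomMass z (l + 1) p := by
  rw [binomCDF, Finset.sum_range_succ, ← binomCDF, binomMass]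

theorem binomMass_zero_right (z : ℕ) (p : ℝ) : binomMass z 0 p = (1 - p) ^ z := by
  simp [binomMass]

theorem binomMass_of_lt {z j : ℕ} (h : z < j) (p : ℝ) : binomMass z j p = 0 := by
  simp [binomMass, Nat.choose_eq_zero_of_lt h]

theorem binomMass_nonneg (z j : ℕ) {p : ℝ} (h0 : 0 ≤ p) (h1 : p ≤ 1) : 0 ≤ binomMass z j p := by
  have : 0 ≤ 1 - p := by linarith
  unfold binomMass; positivity

theorem binomMass_pos {z j : ℕ} (h : j ≤ z) {p : ℝ} (h0 : 0 < p) (h1 : p < 1) :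
    0 < binomMass z j p := by
  have : 0 < 1 - p := by linarith
  have : 0 < z.choose j := Nat.choose_pos h
  unfold binomMass; positivity

theorem binomMass_succ_succ (z j : ℕ) (p : ℝ) :
    binomMass (z + 1) (j + 1) p = (1 - p) * binomMass z (j + 1) p + p * binomMass z j p := by
  unfold binomMass
  rw [Nat.choose_succ_succ, Nat.add_sub_add_right]
  rcases lt_or_ge j z with h | h
  · obtain ⟨d, rfl⟩ := Nat.exists_eq_add_of_lt h
    rw [show j + d + 1 - j = d + 1 by omega, show j + d + 1 - (j + 1) = d by omega]
    push_cast; ring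
  · rw [Nat.choose_eq_zero_of_lt (show z < j + 1 by omega)]
    push_cast; ring

/-- The ratio of consecutive binomial weights, free of side conditions. -/
theorem binomMass_succ_right_mul (z j : ℕ) (p : ℝ) :
    binomMass z (j + 1) p * ((j + 1) * (1 - p)) = binomMass z j p * (((z : ℝ) - j) * p) := by
  rcases lt_or_ge j z with h | h
  · have hc : (z.choose (j + 1) : ℝ) * (j + 1) = z.choose j * ((z : ℝ) - j) := by
      have := Nat.choose_succ_right_eq z j
      rw [← Nat.cast_sub h.le]; exact_mod_cast this
    unfold binomMass
    obtain ⟨d, rfl⟩ := Nat.exists_eq_add_of_lt h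
    rw [show j + d + 1 - j = d + 1 by omega, show j + d + 1 - (j + 1) = d by omega]
    linear_combination (p ^ (j + 1) * (1 - p) ^ (d + 1)) * hc
  · rw [binomMass_of_lt (by omega)]
    rcases h.eq_or_lt with rfl | h
    · simp
    · rw [binomMass_of_lt h]; simp

/-- The ratio of binomial weights for consecutive numbers of trials. -/
theorem binomMass_pred_left_mul (z l : ℕ) (p : ℝ) :
    (1 - p) * (z * binomMass (z - 1) l p) = ((z : ℝ) - l) * binomMass z l p := by
  rcases z with _ | z
  · rcases l with _ | l
    · simp
    · simp [binomMass_of_lt]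
  · rw [Nat.add_sub_cancel]
    rcases lt_or_ge z l with h | h
    · rw [binomMass_of_lt h]
      rcases Nat.lt_or_ge (z + 1) l with h' | h'
      · rw [binomMass_of_lt h']; simp
      · rw [show l = z + 1 by omega]; push_cast; ring
    · have hc : ((z + 1 : ℕ) : ℝ) * z.choose l = (z + 1).choose l * (((z + 1 : ℕ) : ℝ) - l) := by
        have h2 := Nat.choose_mul_succ_eq z l
        rw [← Nat.cast_sub (by omega), mul_comm]; exact_mod_cast h2
      unfold binomMass
      obtain ⟨d, rfl⟩ := Nat.exists_eq_add_of_le h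
      rw [show l + d + 1 - l = d + 1 by omega, show l + d - l = d by omega]
      linear_combination (p ^ l * (1 - p) ^ (d + 1)) * hc

theorem binomCDF_succ_left (z l : ℕ) (p : ℝ) :
    binomCDF (z + 1) l p = binomCDF z l p - p * binomMass z l p := by
  induction l with
  | zero => rw [binomCDF_zero_right, binomCDF_zero_right, binomMass_zero_right]; ring
  | succ l ih =>
    rw [binomCDF_succ_right, ih, binomCDF_succ_right, binomMass_succ_succ]; ring

theorem binomCDF_succ_succ (z l : ℕ) (p : ℝ) :
    binomCDF (z + 1) (l + 1) p = (1 - p) * binomCDF z (l + 1) p + p * binomCDF z l p := by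
  rw [binomCDF_succ_left, binomCDF_succ_right]; ring

theorem binomCDF_of_le {z l : ℕ} (h : z ≤ l) (p : ℝ) : binomCDF z l p = 1 := by
  induction z with
  | zero =>
    induction l with
    | zero => simp [binomCDF]
    | succ l ih =>
      rw [binomCDF_succ_right, ih (Nat.zero_le l), binomMass_of_lt (by omega), add_zero]
  | succ z ih => rw [binomCDF_succ_left, ih (by omega), binomMass_of_lt (by omega)]; ring

theorem binomCDF_one_of_lt {z l : ℕ} (h : l < z) : binomCDF z l 1 = 0 := by
  refine Finset.sum_eq_zero fun j hj => ?_
  rw [Finset.mem_range] at hj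
  simp [show z - j ≠ 0 by omega]

section UnitInterval

variable {p : ℝ} (h0 : 0 ≤ p) (h1 : p ≤ 1)
include h0 h1

theorem binomCDF_nonneg (z l : ℕ) : 0 ≤ binomCDF z l p :=
  Finset.sum_nonneg fun j _ => binomMass_nonneg z j h0 h1

theorem antitone_binomCDF_left (l : ℕ) : Antitone fun z => binomCDF z l p :=
  antitone_nat_of_succ_le fun z => by
    have := mul_nonneg h0 (binomMass_nonneg z l h0 h1)
    simp only [binomCDF_succ_left]; linarith

theorem binomCDF_le_one (z l : ℕ) : binomCDF z l p ≤ 1 := by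
  simpa [binomCDF_of_le (Nat.zero_le l)] using antitone_binomCDF_left h0 h1 l (Nat.zero_le z)

theorem mul_binomCDF_le_succ (z l : ℕ) : (1 - p) * binomCDF z l p ≤ binomCDF (z + 1) l p := by
  rcases l with _ | l
  · rw [binomCDF_zero_right, binomCDF_zero_right, pow_succ']
  · have := mul_nonneg h0 (binomCDF_nonneg h0 h1 z l)
    rw [binomCDF_succ_succ]; linarith

theorem pow_le_binomCDF (z l : ℕ) : (1 - p) ^ z ≤ binomCDF z l p := by
  have := Finset.single_le_sum (f := fun j => binomMass z j p)
    (fun j _ => binomMass_nonneg z j h0 h1) (Finset.mem_range.2 (Nat.succ_pos l))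
  rw [← binomMass_zero_right]
  exact this

theorem binomCDF_le_succ_right (z l : ℕ) : binomCDF z l p ≤ binomCDF z (l + 1) p := by
  rw [binomCDF_succ_right]; linarith [binomMass_nonneg z (l + 1) h0 h1]

end UnitInterval

theorem binomCDF_anti_param (z l : ℕ) {p q : ℝ} (h0 : 0 ≤ p) (hpq : p ≤ q) (h1 : q ≤ 1) :
    binomCDF z l q ≤ binomCDF z l p := by
  induction z generalizing l with
  | zero => rw [binomCDF_of_le (Nat.zero_le l), binomCDF_of_le (Nat.zero_le l)]
  | succ z ih =>
    rcases l with _ | l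
    · rw [binomCDF_zero_right, binomCDF_zero_right]
      exact pow_le_pow_left₀ (by linarith) (by linarith) _
    · rw [binomCDF_succ_succ, binomCDF_succ_succ]
      have a1 := mul_le_mul_of_nonneg_left (ih (l + 1)) (show 0 ≤ 1 - q by linarith)
      have a2 := mul_le_mul_of_nonneg_left (ih l) (h0.trans hpq)
      have a3 := mul_le_mul_of_nonneg_left
        (binomCDF_le_succ_right h0 (hpq.trans h1) z l) (sub_nonneg.2 hpq)
      linarith

/-! ### Ratio asymptotics and concavity in the number of trials -/

section Ratio

variable {p : ℝ} (h0 : 0 < p) (h1 : p < 1)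
include h0 h1

theorem binomCDF_pos (z l : ℕ) : 0 < binomCDF z l p :=
  (pow_pos (by linarith) z).trans_le (pow_le_binomCDF h0.le h1.le z l)

theorem cdf_div_mass_succ_right {z l : ℕ} (h : l < z) :
    binomCDF z (l + 1) p / binomMass z (l + 1) p =
      1 + binomCDF z l p / binomMass z l p * ((l + 1) * (1 - p) / (((z : ℝ) - l) * p)) := by
  have m1 := binomMass_pos (show l + 1 ≤ z by omega) h0 h1
  have m2 := binomMass_pos h.le h0 h1
  have hz : 0 < (z : ℝ) - l := sub_pos.2 (by exact_mod_cast h)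
  have hr := binomMass_succ_right_mul z l p
  have hl : (0 : ℝ) < (l + 1) * (1 - p) := mul_pos (by positivity) (by linarith)
  have hq : 0 < 1 - p := by linarith
  rw [binomCDF_succ_right, add_div, div_self m1.ne', add_comm, div_mul_div_comm]
  congr 1
  rw [div_eq_div_iff m1.ne' (by positivity)]
  linear_combination (-binomCDF z l p) * hr

theorem cdf_div_mass_antitone (l : ℕ) {z : ℕ} (h : l ≤ z) :
    binomCDF (z + 1) l p / binomMass (z + 1) l p ≤ binomCDF z l p / binomMass z l p := by
  induction l generalizing z with
  | zero =>
    have : 0 < 1 - p := by linarith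
    rw [binomCDF_zero_right, binomCDF_zero_right, binomMass_zero_right, binomMass_zero_right,
      div_self (by positivity), div_self (by positivity)]
  | succ l ih =>
    rw [cdf_div_mass_succ_right h0 h1 h, cdf_div_mass_succ_right h0 h1 (h.trans z.le_succ)]
    have hz : 0 < (z : ℝ) - l := sub_pos.2 (by exact_mod_cast h)
    have hq : 0 < 1 - p := by linarith
    have hB := binomCDF_pos h0 h1 z l
    have hm := binomMass_pos (show l ≤ z by omega) h0 h1
    have hi := ih (show l ≤ z by omega)
    have hB := binomCDF_pos h0 h1 (z + 1) l
    have hm := binomMass_pos (show l ≤ z + 1 by omega) h0 h1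
    have hd : (l + 1) * (1 - p) / (((z.succ : ℝ) - l) * p) ≤
        (l + 1) * (1 - p) / (((z : ℝ) - l) * p) := by
      gcongr
      omega
    have hz' : 0 ≤ (l + 1) * (1 - p) / (((z.succ : ℝ) - l) * p) := by
      have : (z : ℝ) ≤ z.succ := by exact_mod_cast z.le_succ
      have : 0 ≤ (z.succ : ℝ) - l := by linarith
      positivity
    exact add_le_add_right (mul_le_mul hi hd hz' ((div_pos hB hm).le.trans hi)) 1

theorem tendsto_cdf_div_mass (l : ℕ) :
    Tendsto (fun z => binomCDF z l p / binomMass z l p) atTop (𝓝 1) := by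
  have hq : 0 < 1 - p := by linarith
  induction l with
  | zero =>
    refine tendsto_const_nhds.congr fun z => ?_
    rw [binomCDF_zero_right, binomMass_zero_right, div_self (by positivity)]
  | succ l ih =>
    have hz : Tendsto (fun z : ℕ => ((l : ℝ) + 1) * (1 - p) / (((z : ℝ) - l) * p)) atTop (𝓝 0) :=
      tendsto_const_nhds.div_atTop
        ((tendsto_atTop_add_const_right _ _ tendsto_natCast_atTop_atTop).atTop_mul_const h0)
    have := (ih.mul hz).const_add 1
    rw [mul_zero, add_zero] at this
    refine this.congr' ?_
    filter_upwards [eventually_gt_atTop l] with z h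
    rw [cdf_div_mass_succ_right h0 h1 h]

theorem tendsto_binomCDF_succ_div (l : ℕ) :
    Tendsto (fun z => binomCDF (z + 1) l p / binomCDF z l p) atTop (𝓝 (1 - p)) := by
  have := ((tendsto_cdf_div_mass h0 h1 l).inv₀ one_ne_zero).const_mul p |>.const_sub 1
  rw [inv_one, mul_one] at this
  refine this.congr fun z => ?_
  have := binomCDF_pos h0 h1 z l
  rw [binomCDF_succ_left, inv_div]
  field_simp

/-- Up to a constant, the distribution function decays geometrically in the number of trials, at
every rate above `1 - p`. -/
theorem exists_binomCDF_le (l : ℕ) {ρ : ℝ} (hρ : 1 - p < ρ) (hρ1 : ρ < 1) :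
    ∃ C, 0 < C ∧ ∀ z, binomCDF z l p ≤ C * ρ ^ z := by
  have hρ0 : 0 < ρ := by linarith
  obtain ⟨Z, hZ⟩ := eventually_atTop.1
    ((tendsto_binomCDF_succ_div h0 h1 l).eventually (gt_mem_nhds hρ))
  refine ⟨(ρ ^ Z)⁻¹, by positivity, fun z => ?_⟩
  rcases le_total z Z with h | h
  · refine (binomCDF_le_one h0.le h1.le z l).trans ?_
    rw [inv_mul_eq_div, one_le_div (by positivity)]
    exact pow_le_pow_of_le_one hρ0.le hρ1.le h
  · induction z, h using Nat.le_induction with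
    | base =>
      rw [inv_mul_cancel₀ (by positivity)]
      exact binomCDF_le_one h0.le h1.le Z l
    | succ z h ih =>
      have h2 := hZ z h
      rw [div_lt_iff₀ (binomCDF_pos h0 h1 z l)] at h2
      rw [pow_succ']
      nlinarith

theorem tendsto_mul_binomCDF (l : ℕ) :
    Tendsto (fun z : ℕ => (z : ℝ) * binomCDF z l p) atTop (𝓝 0) := by
  obtain ⟨C, -, hC⟩ := exists_binomCDF_le h0 h1 l (ρ := 1 - p / 2) (by linarith) (by linarith)
  have h := (tendsto_self_mul_const_pow_of_lt_one (r := 1 - p / 2)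
    (by linarith) (by linarith)).const_mul C
  rw [mul_zero] at h
  refine squeeze_zero (fun z => mul_nonneg z.cast_nonneg (binomCDF_nonneg h0.le h1.le z l))
    (fun z => ?_) h
  have := mul_le_mul_of_nonneg_left (hC z) (Nat.cast_nonneg (α := ℝ) z)
  linarith

theorem tendsto_binomCDF (l : ℕ) : Tendsto (fun z : ℕ => binomCDF z l p) atTop (𝓝 0) := by
  refine squeeze_zero' (Eventually.of_forall fun z => binomCDF_nonneg h0.le h1.le z l) ?_
    (tendsto_mul_binomCDF h0 h1 l)
  filter_upwards [eventually_ge_atTop 1] with z hz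
  have : (1 : ℝ) ≤ z := by exact_mod_cast hz
  exact le_mul_of_one_le_left (binomCDF_nonneg h0.le h1.le z l) this

/-- The slope of the chord from the point `(B z, z * B (z - 1))` to the next one,
`(B (z + 1), (z + 1) * B z)`, where `B z = binomCDF z l p`. -/
noncomputable def chordSlope (l : ℕ) (p : ℝ) (z : ℕ) : ℝ :=
  (((z + 1 : ℕ) : ℝ) * binomCDF z l p - z * binomCDF (z - 1) l p) /
    (binomCDF (z + 1) l p - binomCDF z l p)

omit h0 h1 in
theorem mul_binomCDF_pred (z l : ℕ) (p : ℝ) :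
    (z : ℝ) * binomCDF (z - 1) l p = z * binomCDF z l p + p * (z * binomMass (z - 1) l p) := by
  rcases z with _ | z
  · simp
  · rw [Nat.add_sub_cancel, binomCDF_succ_left]; ring

theorem chordSlope_eq {l z : ℕ} (h : l ≤ z) :
    chordSlope l p z = -(binomCDF z l p / binomMass z l p) / p + ((z : ℝ) - l) / (1 - p) := by
  have hm := binomMass_pos h h0 h1
  have hq : 1 - p ≠ 0 := by linarith
  have hr : (z : ℝ) * binomMass (z - 1) l p = ((z : ℝ) - l) * binomMass z l p / (1 - p) := by
    rw [← binomMass_pred_left_mul]; field_simp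
  rw [chordSlope, mul_binomCDF_pred, hr, binomCDF_succ_left]
  have : binomCDF z l p - p * binomMass z l p - binomCDF z l p = -(p * binomMass z l p) := by ring
  rw [this]
  push_cast
  field_simp
  ring

theorem chordSlope_mono {l a b : ℕ} (ha : l ≤ a) (hab : a ≤ b) :
    chordSlope l p a ≤ chordSlope l p b := by
  induction b, hab using Nat.le_induction with
  | base => rfl
  | succ b h ih =>
    refine ih.trans ?_
    have hq : 0 < 1 - p := by linarith
    rw [chordSlope_eq h0 h1 (ha.trans h), chordSlope_eq h0 h1 (by omega)]
    have := cdf_div_mass_antitone h0 h1 l (ha.trans h)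
    gcongr
    omega

theorem chord_step {l z : ℕ} (h : l ≤ z) :
    ((z + 1 : ℕ) : ℝ) * binomCDF z l p - z * binomCDF (z - 1) l p =
      chordSlope l p z * (binomCDF (z + 1) l p - binomCDF z l p) := by
  have : binomCDF (z + 1) l p - binomCDF z l p ≠ 0 := by
    have := mul_pos h0 (binomMass_pos h h0 h1)
    rw [binomCDF_succ_left]; linarith
  rw [chordSlope, div_mul_cancel₀ _ this]

/-- The line through two consecutive points `(B a, a * B (a - 1))` and
`(B (a + 1), (a + 1) * B a)`, `a ≥ l`, lies above all points `(B z, z * B (z - 1))`. -/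
theorem mul_binomCDF_pred_le_chord {l a : ℕ} (ha : l ≤ a) (z : ℕ) :
    (z : ℝ) * binomCDF (z - 1) l p ≤
      a * binomCDF (a - 1) l p + chordSlope l p a * (binomCDF z l p - binomCDF a l p) := by
  rcases le_total a z with h | h
  · induction z, h using Nat.le_induction with
    | base => simp
    | succ z h ih =>
      have s := chord_step h0 h1 (ha.trans h)
      have m := chordSlope_mono h0 h1 ha h
      have d := antitone_binomCDF_left h0.le h1.le l z.le_succ
      simp only at d
      rw [Nat.add_sub_cancel]
      nlinarith
  · have key : ∀ y, y ≤ a → l ≤ y → (y : ℝ) * binomCDF (y - 1) l p ≤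
        a * binomCDF (a - 1) l p + chordSlope l p a * (binomCDF y l p - binomCDF a l p) := by
      intro y h
      induction h using Nat.decreasingInduction with
      | self => simp
      | of_succ z h ih =>
        intro hz
        have ih := ih (by omega)
        have s := chord_step h0 h1 hz
        have m := chordSlope_mono h0 h1 hz h.le
        have d := antitone_binomCDF_left h0.le h1.le l z.le_succ
        simp only at d
        rw [Nat.add_sub_cancel] at ih
        nlinarith
    rcases le_total l z with hz | hz
    · exact key z h hz
    · -- points with `z ≤ l` have the same abscissa `1`, and `z = l` is the highest of them
      have key := key l ha le_rfl
      rw [binomCDF_of_le (show l - 1 ≤ l by omega), binomCDF_of_le le_rfl] at key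
      rw [binomCDF_of_le (show z - 1 ≤ l by omega), binomCDF_of_le hz]
      have : (z : ℝ) ≤ l := by exact_mod_cast hz
      linarith

end Ratio
/-! ### Sums over binary sequences -/

theorem sum_bool_snoc {n : ℕ} (f : (Fin (n + 1) → Bool) → ℝ) :
    ∑ y, f y = ∑ v : Fin n → Bool, (f (Fin.snoc v true) + f (Fin.snoc v false)) := by
  rw [← (Fin.snocEquiv fun _ : Fin (n + 1) => Bool).sum_comp f, Fintype.sum_prod_type,
    Fintype.sum_bool, ← Finset.sum_add_distrib]
  rfl

theorem failures_eq_sum {m : ℕ} (y : Fin m → Bool) :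
    failures y = ∑ i, if y i = true then 1 else 0 := by
  rw [failures, Finset.card_filter]

theorem failures_castSucc_add {n : ℕ} (y : Fin (n + 1) → Bool) :
    failures y = failures (fun i : Fin n => y i.castSucc) +
      if y (Fin.last n) = true then 1 else 0 := by
  rw [failures_eq_sum, failures_eq_sum, Fin.sum_univ_castSucc]

theorem failures_le {m : ℕ} (y : Fin m → Bool) : failures y ≤ m :=
  (Finset.card_filter_le _ _).trans_eq (by simp)

theorem failures_comp_perm {m : ℕ} (σ : Equiv.Perm (Fin m)) (y : Fin m → Bool) :
    failures (y ∘ σ) = failures y := by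
  rw [failures_eq_sum, failures_eq_sum]
  exact Equiv.sum_comp σ fun i => if y i = true then 1 else 0

theorem exists_failures_eq {m z : ℕ} (h : z ≤ m) : ∃ y : Fin m → Bool, failures y = z := by
  obtain ⟨s, -, hs⟩ := Finset.exists_subset_card_eq (s := (Finset.univ : Finset (Fin m))) (n := z)
    (by simpa using h)
  exact ⟨fun i => decide (i ∈ s), by simp [failures, hs]⟩

/-- Given the observed variables, the number of recorded failures is binomial with the number of
observed failures as its number of trials. -/
theorem sum_prod_noise (lam : ℝ) {n : ℕ} (y : Fin n → Bool) (l : ℕ) :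
    (∑ u : Fin n → Bool, if failures u ≤ l then ∏ i, noise lam (y i) (u i) else 0) =
      binomCDF (failures y) l (1 - lam) := by
  induction n generalizing l with
  | zero => simp [failures, binomCDF_of_le]
  | succ n ih =>
    rw [sum_bool_snoc, failures_castSucc_add y]
    simp only [failures_castSucc_add (Fin.snoc _ _), Fin.prod_univ_castSucc, Fin.snoc_castSucc,
      Fin.snoc_last]
    rw [Finset.sum_add_distrib]
    cases y (Fin.last n) with
    | false =>
      have n1 : noise lam false true = 0 := rfl
      have n2 : noise lam false false = 1 := rfl
      simp only [n1, n2, mul_zero, mul_one, ite_self, Finset.sum_const_zero, zero_add,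
        Bool.false_eq_true, if_false, add_zero]
      exact ih (fun i => y i.castSucc) l
    | true =>
      have e (c : ℝ) (P : Prop) [Decidable P] (x : ℝ) :
          (if P then x * c else 0) = (if P then x else 0) * c := by split_ifs <;> simp
      have n1 : noise lam true true = 1 - lam := rfl
      have n2 : noise lam true false = lam := rfl
      simp only [n1, n2, e, ← Finset.sum_mul, if_true, Bool.false_eq_true, if_false, add_zero]
      have hi := ih (fun i => y i.castSucc)
      rw [hi l]
      rcases l with _ | l
      · rw [binomCDF_zero_right, binomCDF_zero_right]
        simp [pow_succ]
      · simp only [Nat.add_le_add_iff_right]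
        rw [hi l, binomCDF_succ_succ]
        ring

theorem prob_mono {Ω : Type*} [Fintype Ω] {P : Ω → ℝ} (hP : ∀ ω, 0 ≤ P ω) {A B : Set Ω}
    (h : A ⊆ B) : prob P A ≤ prob P B :=
  Finset.sum_le_sum fun ω _ => Set.indicator_le_indicator_of_subset h hP ω

theorem condProb_le_one {Ω : Type*} [Fintype Ω] {P : Ω → ℝ} (hP : ∀ ω, 0 ≤ P ω) (A B : Set Ω) :
    condProb P A B ≤ 1 :=
  div_le_one_of_le₀ (prob_mono hP Set.inter_subset_right)
    (Finset.sum_nonneg fun ω _ => Set.indicator_nonneg (fun ω _ => hP ω) ω)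

/-! ### Reduction of exchangeable laws to mixtures over the number of failures -/

/-- The probability of `L ≤ l` when `z` failures are placed uniformly at random among the `n + 1`
variables. For `z = 0` the truncated `z - 1` is multiplied by `0`. -/
noncomputable def acceptProb (lam : ℝ) (l n z : ℕ) : ℝ :=
  z / (n + 1) * binomCDF (z - 1) l (1 - lam) + (1 - z / (n + 1)) * binomCDF z l (1 - lam)

/-- The probability of `L ≤ l` and `Yₙ₊₁ = 1` when `z` failures are placed uniformly at random
among the `n + 1` variables. -/
noncomputable def acceptFailProb (lam : ℝ) (l n z : ℕ) : ℝ :=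
  z / (n + 1) * binomCDF (z - 1) l (1 - lam)

/-- Under an exchangeable law, the last variable may be averaged over all positions. -/
theorem sum_exchangeable {n : ℕ} {Q : (Fin (n + 1) → Bool) → ℝ}
    (hQ : ∀ (σ : Equiv.Perm (Fin (n + 1))) (y : Fin (n + 1) → Bool), Q (y ∘ σ) = Q y)
    (φ : Bool → ℕ → ℝ) :
    ∑ y, Q y * φ (y (Fin.last n)) (failures y) =
      ∑ y, Q y * ((failures y : ℝ) / (n + 1) * φ true (failures y) +
        (1 - (failures y : ℝ) / (n + 1)) * φ false (failures y)) := by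
  have h1 (i : Fin (n + 1)) : ∑ y, Q y * φ (y (Fin.last n)) (failures y) =
      ∑ y, Q y * φ (y i) (failures y) := by
    refine Fintype.sum_equiv (Equiv.arrowCongr (Equiv.swap i (Fin.last n)) (Equiv.refl Bool)) _ _
      fun y => ?_
    have : (Equiv.arrowCongr (Equiv.swap i (Fin.last n)) (Equiv.refl Bool)) y =
        y ∘ (Equiv.swap i (Fin.last n)) := by
      ext j; simp [Equiv.arrowCongr]
    rw [this, hQ, failures_comp_perm]
    simp
  have h2 : ((n : ℝ) + 1) * ∑ y, Q y * φ (y (Fin.last n)) (failures y) =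
      ∑ i : Fin (n + 1), ∑ y, Q y * φ (y i) (failures y) := by
    rw [← Finset.sum_congr rfl fun i _ => h1 i]
    simp
  have h3 (y : Fin (n + 1) → Bool) (t : ℕ) : ∑ i, φ (y i) t =
      failures y * φ true t + ((n : ℝ) + 1 - failures y) * φ false t := by
    have e (i : Fin (n + 1)) : φ (y i) t =
        ((if y i = true then 1 else 0 : ℕ) : ℝ) * (φ true t - φ false t) + φ false t := by
      cases y i <;> simp
    rw [Finset.sum_congr rfl fun i _ => e i, Finset.sum_add_distrib, ← Finset.sum_mul,
      ← Nat.cast_sum, ← failures_eq_sum]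
    simp
    ring
  have hn : (n : ℝ) + 1 ≠ 0 := by positivity
  rw [Finset.sum_comm] at h2
  rw [← mul_right_inj' hn, h2, Finset.mul_sum]
  refine Finset.sum_congr rfl fun y _ => ?_
  rw [← Finset.mul_sum, h3]
  field_simp

theorem prob_noisyLaw {n : ℕ} (lam : ℝ) (l : ℕ) (Q : (Fin (n + 1) → Bool) → ℝ)
    (A : Set (Fin (n + 1) → Bool)) :
    prob (noisyLaw lam Q) ({ω | ω.1 ∈ A} ∩ {ω | failures ω.2 ≤ l}) =
      ∑ y, A.indicator Q y * binomCDF (failures fun i : Fin n => y i.castSucc) l (1 - lam) := by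
  classical
  rw [prob, Fintype.sum_prod_type]
  refine Finset.sum_congr rfl fun y _ => ?_
  rw [← sum_prod_noise, Finset.mul_sum]
  refine Finset.sum_congr rfl fun u _ => ?_
  by_cases h1 : y ∈ A <;> by_cases h2 : failures u ≤ l <;> simp [Set.indicator, noisyLaw, h1, h2]

theorem prob_accept {n : ℕ} (lam : ℝ) (l : ℕ) {Q : (Fin (n + 1) → Bool) → ℝ}
    (hQ : Q ∈ exchangeableLaws (n + 1)) :
    prob (noisyLaw lam Q) {ω | failures ω.2 ≤ l} =
      ∑ y, Q y * acceptProb lam l n (failures y) := by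
  have h := prob_noisyLaw lam l Q Set.univ
  have h2 := sum_exchangeable hQ.2
    (fun b z => binomCDF (z - if b = true then 1 else 0) l (1 - lam))
  simp only [Set.mem_univ, Set.ofPred_true, Set.univ_inter, Set.indicator_univ] at h
  rw [h]
  simp only [if_true, Bool.false_eq_true, if_false, Nat.sub_zero] at h2
  refine Eq.trans (Finset.sum_congr rfl fun y _ => ?_) h2
  rw [failures_castSucc_add y, Nat.add_sub_cancel]

theorem prob_acceptFail {n : ℕ} (lam : ℝ) (l : ℕ) {Q : (Fin (n + 1) → Bool) → ℝ}
    (hQ : Q ∈ exchangeableLaws (n + 1)) :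
    prob (noisyLaw lam Q) ({ω | ω.1 (Fin.last n) = true} ∩ {ω | failures ω.2 ≤ l}) =
      ∑ y, Q y * acceptFailProb lam l n (failures y) := by
  have h := prob_noisyLaw lam l Q {y | y (Fin.last n) = true}
  have h2 := sum_exchangeable hQ.2
    (fun b z => if b = true then binomCDF (z - 1) l (1 - lam) else 0)
  simp only [Set.mem_ofPred_eq] at h
  rw [h]
  simp only [if_true, Bool.false_eq_true, if_false, mul_zero, add_zero] at h2
  refine Eq.trans (Finset.sum_congr rfl fun y _ => ?_) h2
  rw [failures_castSucc_add y]
  by_cases hy : y (Fin.last n) = true <;> simp [hy]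

theorem noisyLaw_nonneg {n : ℕ} {lam : ℝ} (h0 : 0 ≤ lam) (h1 : lam ≤ 1)
    {Q : (Fin (n + 1) → Bool) → ℝ} (hQ : Q ∈ exchangeableLaws (n + 1)) (ω) :
    0 ≤ noisyLaw lam Q ω := by
  refine mul_nonneg (hQ.1.1 _) (Finset.prod_nonneg fun i _ => ?_)
  cases ω.1 i.castSucc <;> cases ω.2 i <;> simp [noise, h0, h1]

/-- The law of `m` binary variables that places `z` failures uniformly at random. -/
noncomputable def uniformLaw (m z : ℕ) (y : Fin m → Bool) : ℝ :=
  if failures y = z then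
    ((Finset.univ.filter fun y : Fin m → Bool => failures y = z).card : ℝ)⁻¹ else 0

theorem sum_uniformLaw_mul {m z : ℕ} (h : z ≤ m) (φ : ℕ → ℝ) :
    ∑ y, uniformLaw m z y * φ (failures y) = φ z := by
  obtain ⟨y₀, hy₀⟩ := exists_failures_eq h
  have hc : ((Finset.univ.filter fun y : Fin m → Bool => failures y = z).card : ℝ) ≠ 0 := by
    exact_mod_cast (Finset.card_pos.2 ⟨y₀, by simp [hy₀]⟩).ne'
  have e (y : Fin m → Bool) : uniformLaw m z y * φ (failures y) = if failures y = z then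
      ((Finset.univ.filter fun y : Fin m → Bool => failures y = z).card : ℝ)⁻¹ * φ z else 0 := by
    unfold uniformLaw
    split_ifs with h
    · rw [h]
    · simp
  rw [Finset.sum_congr rfl fun y _ => e y, ← Finset.sum_filter, Finset.sum_const, nsmul_eq_mul,
    mul_inv_cancel_left₀ hc]

theorem uniformLaw_mem {m z : ℕ} (h : z ≤ m) : uniformLaw m z ∈ exchangeableLaws m := by
  refine ⟨⟨fun y => ?_, ?_⟩, fun σ y => ?_⟩
  · unfold uniformLaw; positivity
  · simpa using sum_uniformLaw_mul h fun _ => 1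
  · simp only [uniformLaw, failures_comp_perm]

theorem mix_mem_exchangeableLaws {m : ℕ} {P Q : (Fin m → Bool) → ℝ}
    (hP : P ∈ exchangeableLaws m) (hQ : Q ∈ exchangeableLaws m) {p : ℝ} (h0 : 0 ≤ p)
    (h1 : p ≤ 1) : p • P + (1 - p) • Q ∈ exchangeableLaws m :=
  ⟨convex_stdSimplex ℝ _ hP.1 hQ.1 h0 (by linarith) (by ring), fun σ y => by
    simp [hP.2 σ y, hQ.2 σ y]⟩

/-- A dual certificate for a bound on the upper confidence limit: it suffices to check one linear
inequality, with a multiplier `μ` for the constraint, on the laws with a fixed number of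
failures. -/
theorem upperLimit_le_of_multiplier {lam : ℝ} {l n : ℕ} {ε δ μ : ℝ} (hε : 0 ≤ ε) (hδ : 0 < δ)
    (hμ : 0 ≤ μ)
    (h : ∀ z ≤ n + 1, acceptFailProb lam l n z ≤ ε * acceptProb lam l n z +
      μ * (δ - acceptProb lam l n z)) :
    upperLimit lam l n δ ≤ ε := by
  refine Real.sSup_le ?_ hε
  rintro x ⟨Q, hQ, hd, rfl⟩
  rw [condProb, div_le_iff₀ (hδ.trans_le hd), prob_acceptFail lam l hQ]
  rw [prob_accept lam l hQ] at hd ⊢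
  have h1 : ∑ y, Q y * acceptFailProb lam l n (failures y) ≤
      ∑ y, (ε * (Q y * acceptProb lam l n (failures y)) +
        μ * (δ * Q y - Q y * acceptProb lam l n (failures y))) := by
    refine Finset.sum_le_sum fun y _ => ?_
    have := mul_le_mul_of_nonneg_left (h _ (failures_le y)) (hQ.1.1 y)
    linarith
  rw [Finset.sum_add_distrib, ← Finset.mul_sum, ← Finset.mul_sum, Finset.sum_sub_distrib,
    ← Finset.mul_sum, hQ.1.2] at h1
  have : μ * (δ * 1 - ∑ y, Q y * acceptProb lam l n (failures y)) ≤ 0 :=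
    mul_nonpos_of_nonneg_of_nonpos hμ (by linarith)
  linarith

/-- Bounds on the upper confidence limit constrain all feasible mixtures of two laws with a fixed
number of failures. -/
theorem mix_le_of_upperLimit_le {lam : ℝ} (h0 : 0 ≤ lam) (h1 : lam ≤ 1) {l n : ℕ} {ε δ : ℝ}
    (hδ : 0 < δ) (h : upperLimit lam l n δ ≤ ε) {a b : ℕ} (ha : a ≤ n + 1) (hb : b ≤ n + 1)
    {p : ℝ} (hp0 : 0 ≤ p) (hp1 : p ≤ 1)
    (hd : δ ≤ p * acceptProb lam l n a + (1 - p) * acceptProb lam l n b) :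
    p * acceptFailProb lam l n a + (1 - p) * acceptFailProb lam l n b ≤
      ε * (p * acceptProb lam l n a + (1 - p) * acceptProb lam l n b) := by
  have hQ := mix_mem_exchangeableLaws (uniformLaw_mem ha) (uniformLaw_mem hb) hp0 hp1
  set Q := p • uniformLaw (n + 1) a + (1 - p) • uniformLaw (n + 1) b with hQdef
  have hs (φ : ℕ → ℝ) : ∑ y, Q y * φ (failures y) = p * φ a + (1 - p) * φ b := by
    rw [← sum_uniformLaw_mul ha φ, ← sum_uniformLaw_mul hb φ, Finset.mul_sum, Finset.mul_sum,
      ← Finset.sum_add_distrib]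
    refine Finset.sum_congr rfl fun y _ => ?_
    simp only [hQdef, Pi.add_apply, Pi.smul_apply, smul_eq_mul]
    ring
  have hB := prob_accept lam l hQ
  have hA := prob_acceptFail lam l hQ
  rw [hs] at hA hB
  have hle : condProb (noisyLaw lam Q) {ω | ω.1 (Fin.last n) = true} {ω | failures ω.2 ≤ l} ≤
      ε := by
    refine le_trans (le_csSup ⟨1, ?_⟩ ?_) h
    swap
    · exact ⟨Q, hQ, hB.symm ▸ hd, rfl⟩
    rintro x ⟨P, hP, -, rfl⟩
    exact condProb_le_one (noisyLaw_nonneg h0 h1 hP) _ _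
  rw [condProb, hA, hB, div_le_iff₀ (hδ.trans_le hd)] at hle
  exact hle

/-! ### The iid setting -/

theorem prob_iidLaw (θ : ℝ) (n k : ℕ) :
    prob (iidLaw θ (n + 1)) {y | failures (fun i : Fin n => y i.castSucc) ≤ k} =
      binomCDF n k θ ∧
    prob (iidLaw θ (n + 1)) ({y | y (Fin.last n) = true} ∩
      {y | failures (fun i : Fin n => y i.castSucc) ≤ k}) = θ * binomCDF n k θ := by
  have key : ∑ v : Fin n → Bool, (if failures v ≤ k then iidLaw θ n v else 0) =
      binomCDF n k θ := by
    have := sum_prod_noise (1 - θ) (fun _ : Fin n => true) k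
    have hn : failures (fun _ : Fin n => true) = n := by simp [failures]
    rw [hn, sub_sub_cancel] at this
    rw [← this]
    refine Finset.sum_congr rfl fun v _ => ?_
    have e (i : Fin n) : noise (1 - θ) true (v i) = if v i then θ else 1 - θ := by
      cases v i <;> simp [noise]
    simp only [e, iidLaw]
  constructor
  · rw [prob, sum_bool_snoc, ← key]
    refine Finset.sum_congr rfl fun v _ => ?_
    by_cases h : failures v ≤ k <;>
      simp [Set.indicator, h, iidLaw, Fin.prod_univ_castSucc]
    ring
  · rw [prob, sum_bool_snoc, ← key, Finset.mul_sum]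
    refine Finset.sum_congr rfl fun v _ => ?_
    by_cases h : failures v ≤ k <;>
      simp [Set.indicator, h, iidLaw, Fin.prod_univ_castSucc]
    ring

theorem upperLimitIid_eq {k n : ℕ} {δ : ℝ} (hδ : 0 < δ) :
    upperLimitIid k n δ = sSup {θ | θ ∈ Set.Icc (0 : ℝ) 1 ∧ δ ≤ binomCDF n k θ} := by
  unfold upperLimitIid
  congr 1
  ext x
  constructor
  · rintro ⟨Q, ⟨θ, hθ, rfl⟩, hd, rfl⟩
    rw [condProb, (prob_iidLaw θ n k).2]
    rw [(prob_iidLaw θ n k).1] at hd ⊢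
    rw [mul_div_cancel_right₀ _ (hδ.trans_le hd).ne']
    exact ⟨hθ, hd⟩
  · rintro ⟨hθ, hd⟩
    refine ⟨_, ⟨x, hθ, rfl⟩, (prob_iidLaw x n k).1.symm ▸ hd, ?_⟩
    rw [condProb, (prob_iidLaw x n k).2, (prob_iidLaw x n k).1,
      mul_div_cancel_right₀ _ (hδ.trans_le hd).ne']

theorem upperLimitIid_le {k n : ℕ} {ε δ : ℝ} (hε : 0 ≤ ε) (hδ : 0 < δ)
    (h : binomCDF n k ε < δ) : upperLimitIid k n δ ≤ ε := by
  rw [upperLimitIid_eq hδ]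
  refine Real.sSup_le ?_ hε
  rintro θ ⟨hθ, hd⟩
  by_contra! hlt
  exact (hd.trans (binomCDF_anti_param n k hε hlt.le hθ.2)).not_gt h

theorem binomCDF_le_of_upperLimitIid_le {k n : ℕ} {ε δ : ℝ} (hε : 0 ≤ ε) (hε1 : ε < 1)
    (hδ : 0 < δ) (h : upperLimitIid k n δ ≤ ε) : binomCDF n k ε ≤ δ := by
  rw [upperLimitIid_eq hδ] at h
  have hc : Continuous (binomCDF n k) := by unfold binomCDF; fun_prop
  refine le_of_tendsto (hc.continuousWithinAt (s := Set.Ioi ε)) ?_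
  filter_upwards [Ioo_mem_nhdsGT hε1] with θ hθ
  by_contra! hlt
  have := le_csSup (s := {θ | θ ∈ Set.Icc (0 : ℝ) 1 ∧ δ ≤ binomCDF n k θ})
    ⟨1, fun x hx => hx.1.2⟩ ⟨⟨hε.trans hθ.1.le, hθ.2.le⟩, hlt.le⟩
  linarith [hθ.1]

/-! ### Asymptotics from two-sided bounds -/

theorem isLittleO_of_bounds {F : Filter ℝ} {N s : ℝ → ℝ} {A : ℝ} (hs : Tendsto s F atTop)
    (up : ∀ η > 0, ∃ C, ∀ᶠ x in F, N x ≤ (A + η) * s x + C)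
    (lo : ∀ η > 0, ∃ C, ∀ᶠ x in F, (A - η) * s x ≤ N x + C) :
    (fun x => N x - A * s x) =o[F] s := by
  refine isLittleO_iff.2 fun c hc => ?_
  obtain ⟨C, hC⟩ := up (c / 2) (by positivity)
  obtain ⟨D, hD⟩ := lo (c / 2) (by positivity)
  filter_upwards [hC, hD, hs.eventually_ge_atTop 0, hs.eventually_ge_atTop (C / (c / 2)),
    hs.eventually_ge_atTop (D / (c / 2))] with x h1 h2 h0 h3 h4
  rw [div_le_iff₀ (by positivity)] at h3 h4
  rw [Real.norm_eq_abs, Real.norm_of_nonneg h0, abs_le]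
  constructor <;> linarith

theorem tendsto_log_inv_nhdsGT_zero : Tendsto (fun x : ℝ => Real.log x⁻¹) (𝓝[>] 0) atTop :=
  Real.tendsto_log_atTop.comp tendsto_inv_nhdsGT_zero

theorem eventually_mem_Ioo : ∀ᶠ x : ℝ in 𝓝[>] 0, x ∈ Set.Ioo (0 : ℝ) 1 :=
  Ioo_mem_nhdsGT one_pos

/-! ### The deterministic test -/

section Deterministic

variable {k n : ℕ}

theorem acceptProb_zero_of_le {z : ℕ} (h : z ≤ k) : acceptProb 0 k n z = 1 := by
  rw [acceptProb, binomCDF_of_le (by omega), binomCDF_of_le h]; ring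

theorem acceptFailProb_zero_of_le {z : ℕ} (h : z ≤ k + 1) :
    acceptFailProb 0 k n z = z / (n + 1) := by
  rw [acceptFailProb, binomCDF_of_le (by omega), mul_one]

theorem acceptProb_zero_succ : acceptProb 0 k n (k + 1) = (k + 1) / (n + 1) := by
  rw [acceptProb, binomCDF_of_le (by omega), sub_zero, binomCDF_one_of_lt (by omega)]
  push_cast; ring

theorem acceptProb_zero_of_lt {z : ℕ} (h : k + 1 < z) : acceptProb 0 k n z = 0 := by
  rw [acceptProb, sub_zero, binomCDF_one_of_lt (by omega), binomCDF_one_of_lt (by omega)]; ring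

theorem acceptFailProb_zero_of_lt {z : ℕ} (h : k + 1 < z) : acceptFailProb 0 k n z = 0 := by
  rw [acceptFailProb, sub_zero, binomCDF_one_of_lt (by omega), mul_zero]

variable {ε δ : ℝ}

theorem upperLimit_zero_le (hε0 : 0 < ε) (hδ0 : 0 < δ) (hδ1 : δ < 1)
    (hn : ((k : ℝ) + 1 - δ) / (δ * ε) + (k + 1) ≤ n + 1) :
    upperLimit 0 k n δ ≤ ε := by
  set N : ℝ := n + 1 with hN
  have hN0 : 0 < N := by positivity
  have hk : (0 : ℝ) ≤ k := k.cast_nonneg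
  have hd : 0 < 1 - δ := by linarith
  have h1 : (k : ℝ) + 1 - δ + (k + 1) * (δ * ε) ≤ N * (δ * ε) := by
    have := mul_le_mul_of_nonneg_right hn (mul_pos hδ0 hε0).le
    rwa [add_mul, div_mul_cancel₀ _ (by positivity)] at this
  have h2 : (k : ℝ) ≤ ε * N := by
    by_contra! hlt
    nlinarith [mul_lt_mul_of_pos_left hlt hδ0, mul_pos hδ0 hε0]
  have hμ : 0 ≤ (ε - k / N) / (1 - δ) := by
    have : (k : ℝ) / N ≤ ε := by rwa [div_le_iff₀ hN0]
    exact div_nonneg (by linarith) hd.le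
  -- the multiplier makes the constraint for `z = k` an equality
  refine upperLimit_le_of_multiplier hε0.le hδ0 hμ fun z _ => ?_
  rcases lt_trichotomy z (k + 1) with h | rfl | h
  · rw [acceptFailProb_zero_of_le h.le, acceptProb_zero_of_le (by omega)]
    have : (z : ℝ) ≤ k := by exact_mod_cast Nat.lt_succ_iff.1 h
    have h3 : (ε - k / N) / (1 - δ) * (δ - 1) = -(ε - k / N) := by field_simp; ring
    have h4 : (z : ℝ) / (n + 1) ≤ k / N := by rw [← hN]; gcongr
    rw [h3]; linarith
  · rw [acceptFailProb_zero_of_le le_rfl, acceptProb_zero_succ, ← hN]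
    have h3 : ε * ((k + 1) / N) + (ε - k / N) / (1 - δ) * (δ - (k + 1) / N) -
        ((k + 1 : ℕ) : ℝ) / N =
        (N * (N * (δ * ε) - (k + 1 - δ + (k + 1) * (δ * ε))) + k * (k + 1)) /
          (N ^ 2 * (1 - δ)) := by
      push_cast; field_simp; ring
    have h4 : 0 ≤ N * (δ * ε) - (k + 1 - δ + (k + 1) * (δ * ε)) := by linarith
    have : 0 ≤ (N * (N * (δ * ε) - (k + 1 - δ + (k + 1) * (δ * ε))) + k * (k + 1)) /
          (N ^ 2 * (1 - δ)) := by positivity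
    linarith
  · rw [acceptFailProb_zero_of_lt h, acceptProb_zero_of_lt h]
    have := mul_nonneg hμ hδ0.le
    linarith

theorem le_of_upperLimit_zero_le (hε0 : 0 < ε) (hε1 : ε < 1) (hδ0 : 0 < δ) (hδ1 : δ < 1)
    (hn : k + 1 ≤ n) (h : upperLimit 0 k n δ ≤ ε) :
    ((k : ℝ) + 1 - δ) / (δ * ε) ≤ n + 1 := by
  set N : ℝ := n + 1 with hN
  have hN0 : 0 < N := by positivity
  have hkN : (k : ℝ) + 1 < N := by
    have : ((k + 1 : ℕ) : ℝ) ≤ n := by exact_mod_cast hn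
    push_cast at this; linarith
  have key {p : ℝ} (hp0 : 0 ≤ p) (hp1 : p ≤ 1) (hd) :=
    mix_le_of_upperLimit_le le_rfl zero_le_one hδ0 h (a := k + 1) (b := k) (by omega) (by omega)
      (p := p) hp0 hp1 hd
  rw [acceptFailProb_zero_of_le le_rfl, acceptProb_zero_succ, acceptProb_zero_of_le le_rfl,
    acceptFailProb_zero_of_le (by omega), ← hN] at key
  set c := ((k : ℝ) + 1) / N with hc
  have hc0 : 0 < c := by positivity
  have hc1 : c < 1 := (div_lt_one hN0).2 hkN
  have hcδ : c < δ := by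
    -- otherwise the law with `k + 1` failures is feasible, with conditional probability `1`
    by_contra! hle
    have := key zero_le_one le_rfl (by linarith)
    push_cast at this
    rw [← hc] at this
    nlinarith
  have hc1' : 0 < 1 - c := by linarith
  -- the weight for which the constraint is an equality
  set p := (1 - δ) / (1 - c) with hp
  have e : p * (1 - c) = 1 - δ := div_mul_cancel₀ _ hc1'.ne'
  have hpδ : 1 - δ ≤ p := by
    rw [hp, le_div_iff₀ hc1']; nlinarith
  have h3 := key (p := p) (by linarith) ((div_le_one hc1').2 (by linarith)) (by linarith)
  have h4 : p * c + (1 - p) * 1 = δ := by linarith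
  rw [h4] at h3
  have h5 : p * (((k + 1 : ℕ) : ℝ) / N) + (1 - p) * (k / N) = (k + p) / N := by
    push_cast; ring
  rw [h5, div_le_iff₀ hN0] at h3
  rw [div_le_iff₀ (by positivity)]
  linarith

theorem minObs_zero_bounds (hε0 : 0 < ε) (hε1 : ε < 1) (hδ0 : 0 < δ) (hδ1 : δ < 1) (k : ℕ) :
    (minObs 0 k ε δ : ℝ) ≤ ((k : ℝ) + 1 - δ) / (δ * ε) + (k + 2) ∧
      ((k : ℝ) + 1 - δ) / (δ * ε) ≤ minObs 0 k ε δ + 1 := by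
  set X := ((k : ℝ) + 1 - δ) / (δ * ε) with hX
  have hX0 : 0 < X := div_pos (by linarith [k.cast_nonneg (α := ℝ)]) (by positivity)
  have hmem : ⌈X + (k + 1)⌉₊ ∈ {n | k + 1 ≤ n ∧ upperLimit 0 k n δ ≤ ε} := by
    have hle := Nat.le_ceil (X + (k + 1))
    refine ⟨?_, upperLimit_zero_le hε0 hδ0 hδ1 (by linarith)⟩
    have : ((k + 1 : ℕ) : ℝ) ≤ ⌈X + (k + 1)⌉₊ := by push_cast; linarith
    exact_mod_cast this
  constructor
  · have h1 : (minObs 0 k ε δ : ℝ) ≤ ⌈X + (k + 1)⌉₊ := by exact_mod_cast Nat.sInf_le hmem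
    have h2 := Nat.ceil_lt_add_one (show 0 ≤ X + (k + 1) by positivity)
    linarith
  · obtain ⟨h1, h2⟩ := Nat.sInf_mem ⟨_, hmem⟩
    exact le_of_upperLimit_zero_le hε0 hε1 hδ0 hδ1 h1 h2

end Deterministic

theorem minObs_zero_small_eps (k : ℕ) {δ : ℝ} (hδ0 : 0 < δ) (hδ1 : δ < 1) :
    (fun ε : ℝ => (minObs 0 k ε δ : ℝ) - ((k : ℝ) + 1 - δ) / (δ * ε))
      =o[𝓝[>] 0] (fun ε : ℝ => ε⁻¹) := by
  have e (ε : ℝ) : ((k : ℝ) + 1 - δ) / (δ * ε) = ((k : ℝ) + 1 - δ) / δ * ε⁻¹ := by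
    rw [div_mul_eq_div_div, div_eq_mul_inv _ ε]
  simp only [e]
  refine isLittleO_of_bounds tendsto_inv_nhdsGT_zero (fun η hη => ⟨k + 2, ?_⟩)
    fun η hη => ⟨1, ?_⟩ <;>
  · filter_upwards [eventually_mem_Ioo] with ε ⟨h0, h1⟩
    obtain ⟨hu, hl⟩ := minObs_zero_bounds h0 h1 hδ0 hδ1 k
    rw [e] at hu hl
    have := mul_pos hη (inv_pos.2 h0)
    linarith

theorem minObs_zero_small_delta_bounds (k : ℕ) {ε δ : ℝ} (hε0 : 0 < ε) (hε1 : ε < 1)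
    (hδ0 : 0 < δ) (hδ1 : δ < 1) :
    (minObs 0 k ε δ : ℝ) ≤ ((k : ℝ) + 1) / ε * δ⁻¹ + (k + 2) ∧
      ((k : ℝ) + 1) / ε * δ⁻¹ ≤ minObs 0 k ε δ + (1 + 1 / ε) := by
  obtain ⟨hu, hl⟩ := minObs_zero_bounds hε0 hε1 hδ0 hδ1 k
  have e : ((k : ℝ) + 1 - δ) / (δ * ε) = ((k : ℝ) + 1) / ε * δ⁻¹ - 1 / ε := by
    field_simp
  have : 0 < 1 / ε := by positivity
  rw [e] at hu hl
  constructor <;> linarith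

theorem minObs_zero_small_delta (k : ℕ) {ε : ℝ} (hε0 : 0 < ε) (hε1 : ε < 1) :
    (fun δ : ℝ => (minObs 0 k ε δ : ℝ) - ((k : ℝ) + 1) / (δ * ε))
      =o[𝓝[>] 0] (fun δ : ℝ => δ⁻¹) := by
  have e (δ : ℝ) : ((k : ℝ) + 1) / (δ * ε) = ((k : ℝ) + 1) / ε * δ⁻¹ := by
    rw [mul_comm δ, div_mul_eq_div_div, div_eq_mul_inv _ δ]
  simp only [e]
  refine isLittleO_of_bounds tendsto_inv_nhdsGT_zero (fun η hη => ⟨k + 2, ?_⟩)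
    fun η hη => ⟨1 + 1 / ε, ?_⟩ <;>
  · filter_upwards [eventually_mem_Ioo] with δ ⟨h0, h1⟩
    obtain ⟨hu, hl⟩ := minObs_zero_small_delta_bounds k hε0 hε1 h0 h1
    have := mul_pos hη (inv_pos.2 h0)
    linarith

/-- The logarithm of the deterministic number of observations is `log δ⁻¹` up to a bounded
error. -/
theorem tendsto_log_minObs_zero_div (k : ℕ) {ε : ℝ} (hε0 : 0 < ε) (hε1 : ε < 1) :
    Tendsto (fun δ : ℝ => Real.log (minObs 0 k ε δ) / Real.log δ⁻¹) (𝓝[>] 0) (𝓝 1) := by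
  have hA : 0 < ((k : ℝ) + 1) / ε := by positivity
  have hlim : Tendsto (fun δ : ℝ => (minObs 0 k ε δ : ℝ) * δ) (𝓝[>] 0)
      (𝓝 (((k : ℝ) + 1) / ε)) := by
    have h := (minObs_zero_small_delta k hε0 hε1).tendsto_div_nhds_zero.add_const
      (((k : ℝ) + 1) / ε)
    rw [zero_add] at h
    refine h.congr' ?_
    filter_upwards [eventually_mem_Ioo] with δ ⟨h0, _⟩
    field_simp
    ring
  have h := ((hlim.log hA.ne').div_atTop tendsto_log_inv_nhdsGT_zero).add_const 1
  rw [zero_add] at h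
  refine h.congr' ?_
  filter_upwards [eventually_mem_Ioo, tendsto_log_inv_nhdsGT_zero.eventually_gt_atTop 0,
    hlim.eventually (lt_mem_nhds hA)] with δ ⟨h0, _⟩ hl hm
  have hm0 : (minObs 0 k ε δ : ℝ) ≠ 0 := fun h => by simp [h] at hm
  rw [Real.log_inv] at hl
  have hl' : Real.log δ ≠ 0 := by linarith
  rw [Real.log_mul hm0 h0.ne', Real.log_inv]
  field_simp
  ring

/-! ### The iid setting -/

theorem tendsto_one_sub_pow {n : ℝ → ℕ} {t : ℝ}
    (h : Tendsto (fun ε : ℝ => ε * n ε) (𝓝[>] 0) (𝓝 t)) :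
    Tendsto (fun ε : ℝ => (1 - ε) ^ n ε) (𝓝[>] 0) (𝓝 (Real.exp (-t))) := by
  have hd : HasDerivAt (fun x : ℝ => Real.log (1 - x)) (-1) 0 := by
    have := ((hasDerivAt_id (0 : ℝ)).const_sub 1).log (by simp)
    simpa using this
  have h1 := (hasDerivAt_iff_tendsto_slope.1 hd).mono_left
    (nhdsWithin_mono (0 : ℝ) fun x (hx : 0 < x) => hx.ne')
  have h2 := (Real.continuous_exp.tendsto _).comp (h1.mul h)
  rw [neg_one_mul] at h2
  refine h2.congr' ?_
  filter_upwards [eventually_mem_Ioo] with ε ⟨h0, hε1⟩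
  have : slope (fun x : ℝ => Real.log (1 - x)) 0 ε * (ε * n ε) = n ε * Real.log (1 - ε) := by
    simp [slope_def_field]
    field_simp
  rw [Function.comp_apply, this, Real.exp_nat_mul, Real.exp_log (by linarith)]

theorem tendsto_binomMass_poisson {n : ℝ → ℕ} {t : ℝ}
    (h : Tendsto (fun ε : ℝ => ε * n ε) (𝓝[>] 0) (𝓝 t)) (j : ℕ) :
    Tendsto (fun ε : ℝ => binomMass (n ε) j ε) (𝓝[>] 0)
      (𝓝 (Real.exp (-t) * (t ^ j / j.factorial))) := by
  have hid : Tendsto (fun ε : ℝ => ε) (𝓝[>] 0) (𝓝 0) :=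
    tendsto_nhdsWithin_of_tendsto_nhds tendsto_id
  induction j with
  | zero => simpa [binomMass_zero_right] using tendsto_one_sub_pow h
  | succ j ih =>
    have h1 : Tendsto (fun ε : ℝ => (ε * n ε - ε * j) / ((j + 1) * (1 - ε))) (𝓝[>] 0)
        (𝓝 ((t - 0 * j) / ((j + 1) * (1 - 0)))) :=
      (h.sub (hid.mul_const _)).div ((hid.const_sub 1).const_mul _)
        (by rw [sub_zero, mul_one]; positivity)
    have h2 := ih.mul h1
    have e : Real.exp (-t) * (t ^ j / j.factorial) * ((t - 0 * j) / ((j + 1) * (1 - 0))) =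
        Real.exp (-t) * (t ^ (j + 1) / (j + 1).factorial) := by
      rw [Nat.factorial_succ]; push_cast; field_simp; ring
    rw [e] at h2
    refine h2.congr' ?_
    filter_upwards [eventually_mem_Ioo] with ε ⟨h0, hε1⟩
    have hr := binomMass_succ_right_mul (n ε) j ε
    have : 0 < 1 - ε := by linarith
    rw [← mul_div_assoc, div_eq_iff (by positivity), hr]
    ring

/-- The Poisson limit of binomial distribution functions. -/
theorem tendsto_binomCDF_poisCDF {n : ℝ → ℕ} {t : ℝ}
    (h : Tendsto (fun ε : ℝ => ε * n ε) (𝓝[>] 0) (𝓝 t)) (k : ℕ) :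
    Tendsto (fun ε : ℝ => binomCDF (n ε) k ε) (𝓝[>] 0) (𝓝 (poisCDF k t)) := by
  rw [poisCDF, Finset.mul_sum]
  exact tendsto_finsetSum _ fun j _ => tendsto_binomMass_poisson h j

theorem strictAntiOn_poisCDF (k : ℕ) : StrictAntiOn (poisCDF k) (Set.Ici 0) := by
  refine strictAntiOn_of_deriv_neg (convex_Ici 0)
    (fun x _ => (hasDerivAt_poisCDF k x).continuousAt.continuousWithinAt) fun x hx => ?_
  rw [interior_Ici] at hx
  have hx' : 0 < x := hx
  rw [(hasDerivAt_poisCDF k x).deriv]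
  have : 0 < Real.exp (-x) * (x ^ k / (k.factorial : ℝ)) := by positivity
  linarith

theorem minObsIid_small_eps (k : ℕ) {δ : ℝ} (hδ0 : 0 < δ) (hδ1 : δ < 1) :
    (fun ε : ℝ => (minObsIid k ε δ : ℝ) - poisTime k δ * ε⁻¹)
      =o[𝓝[>] 0] (fun ε : ℝ => ε⁻¹) := by
  obtain ⟨⟨ht0, ht⟩, -⟩ := poisTime_spec k hδ0 hδ1
  set t := poisTime k δ
  have hup (η : ℝ) (hη : 0 < η) : ∀ᶠ ε : ℝ in 𝓝[>] 0,
      ⌈(t + η) * ε⁻¹⌉₊ ∈ {n | k + 1 ≤ n ∧ upperLimitIid k n δ ≤ ε} := by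
    have h1 : Tendsto (fun ε : ℝ => ε * ⌈(t + η) * ε⁻¹⌉₊) (𝓝[>] 0) (𝓝 (t + η)) := by
      have := (tendsto_nat_ceil_mul_div_atTop (show 0 ≤ t + η by linarith)).comp
        tendsto_inv_nhdsGT_zero
      refine this.congr fun ε => ?_
      simp [mul_comm]
    have h2 := (tendsto_binomCDF_poisCDF h1 k).eventually (gt_mem_nhds
      (ht ▸ strictAntiOn_poisCDF k ht0 (show 0 ≤ t + η by linarith) (by linarith)))
    have h3 : Tendsto (fun ε : ℝ => (t + η) * ε⁻¹) (𝓝[>] 0) atTop :=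
      tendsto_inv_nhdsGT_zero.const_mul_atTop (by linarith)
    filter_upwards [h2, h3.eventually_ge_atTop ((k + 1 : ℕ) : ℝ), eventually_mem_Ioo]
      with ε hε hk ⟨h0, _⟩
    exact ⟨by exact_mod_cast hk.trans (Nat.le_ceil _), upperLimitIid_le h0.le hδ0 hε⟩
  refine isLittleO_of_bounds tendsto_inv_nhdsGT_zero (fun η hη => ⟨1, ?_⟩)
    fun η hη => ⟨1, ?_⟩
  · filter_upwards [hup η hη, eventually_mem_Ioo] with ε hε ⟨h0, _⟩
    have h1 : (minObsIid k ε δ : ℝ) ≤ ⌈(t + η) * ε⁻¹⌉₊ := by exact_mod_cast Nat.sInf_le hε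
    have : 0 ≤ (t + η) * ε⁻¹ := by positivity
    linarith [Nat.ceil_lt_add_one this]
  · rcases le_or_gt (t - η) 0 with hle | hlt
    · filter_upwards [eventually_mem_Ioo] with ε ⟨h0, _⟩
      have := mul_nonpos_of_nonpos_of_nonneg hle (inv_nonneg.2 h0.le)
      linarith [(minObsIid k ε δ).cast_nonneg (α := ℝ)]
    · have h1 : Tendsto (fun ε : ℝ => ε * ⌊(t - η) * ε⁻¹⌋₊) (𝓝[>] 0) (𝓝 (t - η)) := by
        have := (tendsto_nat_floor_mul_div_atTop hlt.le).comp tendsto_inv_nhdsGT_zero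
        refine this.congr fun ε => ?_
        simp [mul_comm]
      have h2 := (tendsto_binomCDF_poisCDF h1 k).eventually (lt_mem_nhds
        (ht ▸ strictAntiOn_poisCDF k hlt.le ht0 (by linarith)))
      filter_upwards [h2, hup 1 one_pos, eventually_mem_Ioo] with ε hε hne ⟨h0, hε1⟩
      obtain ⟨-, hm⟩ :=
        Nat.sInf_mem (s := {n | k + 1 ≤ n ∧ upperLimitIid k n δ ≤ ε}) ⟨_, hne⟩
      have hB := binomCDF_le_of_upperLimitIid_le h0.le hε1 hδ0 hm
      have hlt : ⌊(t - η) * ε⁻¹⌋₊ ≤ minObsIid k ε δ := by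
        by_contra! hlt
        exact (hB.trans_lt hε).not_ge (antitone_binomCDF_left h0.le hε1.le k hlt.le)
      have hlt' : (⌊(t - η) * ε⁻¹⌋₊ : ℝ) ≤ minObsIid k ε δ := by exact_mod_cast hlt
      linarith [Nat.lt_floor_add_one ((t - η) * ε⁻¹)]

theorem minObsIid_small_delta (k : ℕ) {ε : ℝ} (hε0 : 0 < ε) (hε1 : ε < 1) :
    (fun δ : ℝ => (minObsIid k ε δ : ℝ) - Real.log δ⁻¹ / Real.log (1 - ε)⁻¹)
      =o[𝓝[>] 0] (fun δ : ℝ => Real.log δ⁻¹) := by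
  have hq : 0 < 1 - ε := by linarith
  have hlq : 0 < Real.log (1 - ε)⁻¹ := Real.log_pos ((one_lt_inv₀ hq).2 (by linarith))
  have hup (η : ℝ) (hη : 0 < η) : ∀ᶠ δ : ℝ in 𝓝[>] 0,
      ⌈((Real.log (1 - ε)⁻¹)⁻¹ + η) * Real.log δ⁻¹⌉₊ ∈
        {n | k + 1 ≤ n ∧ upperLimitIid k n δ ≤ ε} := by
    -- a rate `ρ > 1 - ε` that is close enough to `1 - ε`
    obtain ⟨ρ, hρη, hρ⟩ : ∃ ρ, (Real.log ρ⁻¹)⁻¹ < (Real.log (1 - ε)⁻¹)⁻¹ + η ∧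
        ρ ∈ Set.Ioo (1 - ε) 1 := by
      have hc : ContinuousAt (fun ρ : ℝ => (Real.log ρ⁻¹)⁻¹) (1 - ε) :=
        ((continuousAt_id.inv₀ hq.ne').log (inv_ne_zero hq.ne')).inv₀ hlq.ne'
      exact ((hc.continuousWithinAt (s := Set.Ioi (1 - ε)) |>.eventually
        (gt_mem_nhds (lt_add_of_pos_right _ hη))).and
          (Ioo_mem_nhdsGT (by linarith : 1 - ε < 1))).exists
    have hρ0 : 0 < ρ := hq.trans hρ.1
    have hlρ : 0 < Real.log ρ⁻¹ := Real.log_pos ((one_lt_inv₀ hρ0).2 hρ.2)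
    obtain ⟨C, hC0, hC⟩ := exists_binomCDF_le hε0 hε1 k hρ.1 hρ.2
    set a := (Real.log (1 - ε)⁻¹)⁻¹ + η
    have ha : 0 < a := by positivity
    have ha1 : 0 < a * Real.log ρ⁻¹ - 1 := by
      have := mul_lt_mul_of_pos_right hρη hlρ
      rw [inv_mul_cancel₀ hlρ.ne'] at this
      linarith
    filter_upwards [(tendsto_log_inv_nhdsGT_zero.const_mul_atTop ha).eventually_ge_atTop
      ((k + 1 : ℕ) : ℝ), (tendsto_log_inv_nhdsGT_zero.const_mul_atTop ha1).eventually_gt_atTop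
      (Real.log C), eventually_mem_Ioo] with δ hk hL ⟨h0, _⟩
    have hn := Nat.le_ceil (a * Real.log δ⁻¹)
    refine ⟨by exact_mod_cast hk.trans hn, upperLimitIid_le hε0.le h0 ((hC _).trans_lt ?_)⟩
    rw [← Real.log_lt_log_iff (by positivity) h0, Real.log_mul hC0.ne' (by positivity),
      Real.log_pow]
    have := mul_le_mul_of_nonneg_right hn hlρ.le
    have e1 := Real.log_inv δ
    have e2 : (⌈a * Real.log δ⁻¹⌉₊ : ℝ) * Real.log ρ⁻¹ =
        -(⌈a * Real.log δ⁻¹⌉₊ * Real.log ρ) := by rw [Real.log_inv ρ]; ring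
    linarith
  have e (δ : ℝ) : Real.log δ⁻¹ / Real.log (1 - ε)⁻¹ =
      (Real.log (1 - ε)⁻¹)⁻¹ * Real.log δ⁻¹ := div_eq_inv_mul _ _
  simp only [e]
  refine isLittleO_of_bounds tendsto_log_inv_nhdsGT_zero (fun η hη => ⟨1, ?_⟩)
    fun η hη => ⟨0, ?_⟩
  · filter_upwards [hup η hη, tendsto_log_inv_nhdsGT_zero.eventually_ge_atTop 0] with δ hδ h0
    have h1 : (minObsIid k ε δ : ℝ) ≤ ⌈((Real.log (1 - ε)⁻¹)⁻¹ + η) * Real.log δ⁻¹⌉₊ := by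
      exact_mod_cast Nat.sInf_le hδ
    have : 0 ≤ ((Real.log (1 - ε)⁻¹)⁻¹ + η) * Real.log δ⁻¹ := by positivity
    linarith [Nat.ceil_lt_add_one this]
  · filter_upwards [hup 1 one_pos, tendsto_log_inv_nhdsGT_zero.eventually_ge_atTop 0,
      eventually_mem_Ioo] with δ hne hl ⟨h0, _⟩
    obtain ⟨-, hm⟩ :=
        Nat.sInf_mem (s := {n | k + 1 ≤ n ∧ upperLimitIid k n δ ≤ ε}) ⟨_, hne⟩
    have hB := (pow_le_binomCDF hε0.le hε1.le _ k).trans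
      (binomCDF_le_of_upperLimitIid_le hε0.le hε1 h0 hm)
    rw [← Real.log_le_log_iff (by positivity) h0, Real.log_pow] at hB
    have h2 : Real.log δ⁻¹ ≤ minObsIid k ε δ * Real.log (1 - ε)⁻¹ := by
      rw [Real.log_inv, Real.log_inv, minObsIid]; linarith
    have h3 : (Real.log (1 - ε)⁻¹)⁻¹ * Real.log δ⁻¹ ≤ minObsIid k ε δ := by
      rwa [inv_mul_le_iff₀ hlq, mul_comm]
    have := mul_nonneg hη.le hl
    linarith

/-! ### The randomized test -/

section Randomized

variable {lam : ℝ} (hlam0 : 0 < lam) (hlam1 : lam < 1) (l : ℕ)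
include hlam0 hlam1

theorem acceptProb_bounds {n z : ℕ} (hz : z ≤ n + 1) :
    binomCDF z l (1 - lam) ≤ acceptProb lam l n z ∧
      acceptProb lam l n z ≤ binomCDF z l (1 - lam) + z / (n + 1) ∧
      acceptProb lam l n z ≤ binomCDF (z - 1) l (1 - lam) := by
  have hp0 : 0 ≤ 1 - lam := by linarith
  have hp1 : 1 - lam ≤ 1 := by linarith
  have hw1 : (z : ℝ) / (n + 1) ≤ 1 := by
    rw [div_le_one (by positivity)]; exact_mod_cast hz
  have hw0 : (0 : ℝ) ≤ z / (n + 1) := by positivity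
  have ha : binomCDF z l (1 - lam) ≤ binomCDF (z - 1) l (1 - lam) :=
    antitone_binomCDF_left hp0 hp1 l (Nat.sub_le z 1)
  have hb := binomCDF_le_one hp0 hp1 (z - 1) l
  have hc := binomCDF_nonneg hp0 hp1 z l
  unfold acceptProb
  refine ⟨?_, ?_, ?_⟩ <;> nlinarith

theorem zUpper_spec {δ : ℝ} (hδ0 : 0 < δ) (hδ1 : δ < 1) :
    l ≤ zLower l δ lam ∧ zUpper l δ lam = zLower l δ lam + 1 ∧
      δ < binomCDF (zLower l δ lam) l (1 - lam) ∧
      binomCDF (zLower l δ lam + 1) l (1 - lam) ≤ δ := by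
  have hne : {z | l ≤ z ∧ binomCDF z l (1 - lam) ≤ δ}.Nonempty := by
    obtain ⟨z, h1, h2⟩ := ((eventually_ge_atTop l).and
      ((tendsto_binomCDF (p := 1 - lam) (by linarith) (by linarith) l).eventually
        (gt_mem_nhds hδ0))).exists
    exact ⟨z, h1, h2.le⟩
  obtain ⟨h1, h2⟩ := Nat.sInf_mem hne
  change l ≤ zUpper l δ lam at h1
  change binomCDF (zUpper l δ lam) l (1 - lam) ≤ δ at h2
  have h3 : l < zUpper l δ lam := by
    by_contra! h
    rw [binomCDF_of_le h] at h2
    linarith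
  have h4 : zUpper l δ lam = zLower l δ lam + 1 := by unfold zLower; omega
  refine ⟨by omega, h4, ?_, h4 ▸ h2⟩
  have h5 : zLower l δ lam ∉ {z | l ≤ z ∧ binomCDF z l (1 - lam) ≤ δ} :=
    Nat.notMem_of_lt_sInf (by change _ < zUpper l δ lam; omega)
  by_contra! h
  exact h5 ⟨by omega, h⟩

/-- `δ * G` is the ordinate at abscissa `δ` of a line above all points `(B z, z * B (z - 1))`. -/
theorem mul_le_coeffG_add {δ : ℝ} (hδ0 : 0 < δ) (hδ1 : δ < 1) (z : ℕ) :
    (z : ℝ) * binomCDF (z - 1) l (1 - lam) ≤ δ * coeffG l δ lam +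
      chordSlope l (1 - lam) (zLower l δ lam) * (binomCDF z l (1 - lam) - δ) := by
  obtain ⟨h1, h2, h3, h4⟩ := zUpper_spec hlam0 hlam1 l hδ0 hδ1
  have h := mul_binomCDF_pred_le_chord (p := 1 - lam) (by linarith) (by linarith) h1 z
  have e : δ * coeffG l δ lam = zLower l δ lam * binomCDF (zLower l δ lam - 1) l (1 - lam) +
      chordSlope l (1 - lam) (zLower l δ lam) *
        (δ - binomCDF (zLower l δ lam) l (1 - lam)) := by
    have d1 : binomCDF (zLower l δ lam) l (1 - lam) -
      binomCDF (zLower l δ lam + 1) l (1 - lam) ≠ 0 := by linarith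
    simp only [coeffG, chordSlope, h2]
    rw [← neg_sub (binomCDF (zLower l δ lam) l (1 - lam))
      (binomCDF (zLower l δ lam + 1) l (1 - lam))]
    field_simp
    ring
  rw [e]
  linarith

/-- `δ * G` is attained by a mixture of two consecutive numbers of failures. -/
theorem exists_mix_eq_coeffG {δ : ℝ} (hδ0 : 0 < δ) (hδ1 : δ < 1) :
    ∃ (a : ℕ) (p : ℝ), 0 ≤ p ∧ p ≤ 1 ∧
      p * binomCDF a l (1 - lam) + (1 - p) * binomCDF (a + 1) l (1 - lam) = δ ∧
      p * (a * binomCDF (a - 1) l (1 - lam)) +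
        (1 - p) * (((a + 1 : ℕ) : ℝ) * binomCDF a l (1 - lam)) = δ * coeffG l δ lam := by
  obtain ⟨h1, h2, h3, h4⟩ := zUpper_spec hlam0 hlam1 l hδ0 hδ1
  have d1 : 0 < binomCDF (zLower l δ lam) l (1 - lam) -
      binomCDF (zLower l δ lam + 1) l (1 - lam) := by linarith
  refine ⟨zLower l δ lam, (δ - binomCDF (zLower l δ lam + 1) l (1 - lam)) /
    (binomCDF (zLower l δ lam) l (1 - lam) - binomCDF (zLower l δ lam + 1) l (1 - lam)),
    div_nonneg (by linarith) d1.le, (div_le_one d1).2 (by linarith), ?_, ?_⟩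
  · field_simp
    ring
  · simp only [coeffG, h2]
    field_simp
    ring

theorem coeffG_nonneg {δ : ℝ} (hδ0 : 0 < δ) (hδ1 : δ < 1) : 0 ≤ coeffG l δ lam := by
  obtain ⟨a, p, hp0, hp1, -, h⟩ := exists_mix_eq_coeffG hlam0 hlam1 l hδ0 hδ1
  have b1 := binomCDF_nonneg (p := 1 - lam) (by linarith) (by linarith) a l
  have b2 := binomCDF_nonneg (p := 1 - lam) (by linarith) (by linarith) (a - 1) l
  have hp : 0 ≤ 1 - p := by linarith
  have : 0 ≤ δ * coeffG l δ lam := by rw [← h]; positivity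
  exact nonneg_of_mul_nonneg_right this hδ0

theorem eventually_upperLimit_le {δ η : ℝ} (hδ0 : 0 < δ) (hδ1 : δ < 1) (hη : 0 < η) :
    ∃ M : ℝ, ∀ (n : ℕ) (ε : ℝ), 0 < ε → M ≤ n →
      coeffG l δ lam + η ≤ ε * (n + 1) → upperLimit lam l n δ ≤ ε := by
  have hp0 : 0 < 1 - lam := by linarith
  have hp1 : 1 - lam < 1 := by linarith
  set s := chordSlope l (1 - lam) (zLower l δ lam) with hs
  set G := coeffG l δ lam with hG
  set I := δ * (G - s) with hI
  have hline (z : ℕ) : (z : ℝ) * binomCDF (z - 1) l (1 - lam) ≤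
      I + s * binomCDF z l (1 - lam) := by
    have := mul_le_coeffG_add hlam0 hlam1 l hδ0 hδ1 z
    rw [← hs, ← hG] at this
    linarith
  -- the line has positive intercept, since `z * B (z - 1) / B z` is unbounded
  have hI0 : 0 < I := by
    by_contra! hle
    obtain ⟨z, hz⟩ := exists_nat_gt s
    have h1 := hline z
    have h2 : binomCDF z l (1 - lam) ≤ binomCDF (z - 1) l (1 - lam) :=
      antitone_binomCDF_left hp0.le hp1.le l (Nat.sub_le z 1)
    have h3 := binomCDF_pos hp0 hp1 z l
    have h4 := mul_le_mul_of_nonneg_left h2 z.cast_nonneg (α := ℝ)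
    have h5 := mul_lt_mul_of_pos_right hz h3
    linarith
  have htail : Tendsto (fun z : ℕ => (z : ℝ) * binomCDF (z - 1) l (1 - lam) +
      |s| * binomCDF (z - 1) l (1 - lam)) atTop (𝓝 0) := by
    rw [← tendsto_add_atTop_iff_nat 1]
    have := (tendsto_mul_binomCDF hp0 hp1 l).add
      ((tendsto_binomCDF hp0 hp1 l).const_mul (1 + |s|))
    rw [mul_zero, add_zero] at this
    refine this.congr fun z => ?_
    rw [Nat.add_sub_cancel]
    push_cast
    ring
  obtain ⟨Z, hZ⟩ := eventually_atTop.1 (htail.eventually (gt_mem_nhds hI0))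
  have hBZ := binomCDF_pos hp0 hp1 Z l
  refine ⟨|s| * Z / (η * binomCDF Z l (1 - lam)), fun n ε hε hn hεn => ?_⟩
  set N : ℝ := n + 1 with hN
  have hN0 : 0 < N := by positivity
  refine upperLimit_le_of_multiplier (μ := I / (δ * N)) hε.le hδ0 (by positivity) fun z hz => ?_
  obtain ⟨a1, a2, a3⟩ := acceptProb_bounds hlam0 hlam1 l hz
  set h := acceptProb lam l n z
  have hB := binomCDF_pos hp0 hp1 z l
  have hh : 0 < h := hB.trans_le a1
  -- after scaling by `n + 1`, the line through the limiting points may be tilted by `η`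
  have key : (z : ℝ) * binomCDF (z - 1) l (1 - lam) ≤ I + (s + η) * h := by
    rcases le_total Z z with hzZ | hzZ
    · have h1 := hZ z hzZ
      have h2 : -(|s| * binomCDF (z - 1) l (1 - lam)) ≤ s * h := by
        have := mul_le_mul_of_nonneg_left a3 (abs_nonneg s)
        have := mul_le_mul_of_nonneg_right (neg_abs_le s) hh.le
        linarith
      have := mul_pos hη hh
      linarith
    · have h1 := hline z
      have h2 : binomCDF Z l (1 - lam) ≤ binomCDF z l (1 - lam) :=
        antitone_binomCDF_left hp0.le hp1.le l hzZ
      have h3 : |s| * (z / N) ≤ η * binomCDF z l (1 - lam) := by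
        have hzZ' : (z : ℝ) ≤ Z := by exact_mod_cast hzZ
        have h4 : |s| * Z ≤ η * binomCDF Z l (1 - lam) * N := by
          rw [div_le_iff₀ (by positivity)] at hn
          have : 0 < η * binomCDF Z l (1 - lam) := by positivity
          rw [hN]; linarith
        calc |s| * (z / N) ≤ |s| * (Z / N) := by gcongr
          _ = |s| * Z / N := by ring
          _ ≤ η * binomCDF Z l (1 - lam) := by rwa [div_le_iff₀ hN0]
          _ ≤ _ := by gcongr
      have h4 : -(|s| * (z / N)) ≤ s * (h - binomCDF z l (1 - lam)) := by
        have := mul_le_mul_of_nonneg_right (neg_abs_le s) (sub_nonneg.2 a1)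
        have := mul_le_mul_of_nonneg_left (show h - binomCDF z l (1 - lam) ≤ z / N by linarith)
          (abs_nonneg s)
        linarith
      have := mul_le_mul_of_nonneg_left a1 hη.le
      linarith
  have h1 : (G + η) * h ≤ ε * N * h := by gcongr
  have h2 : I / δ = G - s := by rw [hI]; field_simp
  have h3 : (z : ℝ) * binomCDF (z - 1) l (1 - lam) ≤ ε * N * h + I / δ * (δ - h) := by
    have : I / δ * δ = I := div_mul_cancel₀ _ hδ0.ne'
    rw [mul_sub, this, h2]
    linarith
  rw [acceptFailProb, ← hN]
  have e1 : (z : ℝ) / N * binomCDF (z - 1) l (1 - lam) =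
      z * binomCDF (z - 1) l (1 - lam) / N := by ring
  have e2 : ε * h + I / (δ * N) * (δ - h) = (ε * N * h + I / δ * (δ - h)) / N := by field_simp
  rw [e1, e2]
  gcongr

theorem minObs_small_eps {δ : ℝ} (hδ0 : 0 < δ) (hδ1 : δ < 1) :
    (fun ε : ℝ => (minObs lam l ε δ : ℝ) - coeffG l δ lam * ε⁻¹)
      =o[𝓝[>] 0] (fun ε : ℝ => ε⁻¹) := by
  have hp0 : 0 < 1 - lam := by linarith
  have hp1 : 1 - lam < 1 := by linarith
  have hG := coeffG_nonneg hlam0 hlam1 l hδ0 hδ1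
  have hup (η : ℝ) (hη : 0 < η) : ∀ᶠ ε : ℝ in 𝓝[>] 0,
      ⌈(coeffG l δ lam + η) * ε⁻¹⌉₊ ∈ {n | l + 1 ≤ n ∧ upperLimit lam l n δ ≤ ε} := by
    obtain ⟨M, hM⟩ := eventually_upperLimit_le hlam0 hlam1 l hδ0 hδ1 hη
    have ht : Tendsto (fun ε : ℝ => (coeffG l δ lam + η) * ε⁻¹) (𝓝[>] 0) atTop :=
      tendsto_inv_nhdsGT_zero.const_mul_atTop (by linarith)
    filter_upwards [ht.eventually_ge_atTop ((l + 1 : ℕ) : ℝ), ht.eventually_ge_atTop M,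
      eventually_mem_Ioo] with ε h1 h2 ⟨h0, _⟩
    have hc := Nat.le_ceil ((coeffG l δ lam + η) * ε⁻¹)
    refine ⟨by exact_mod_cast h1.trans hc, hM _ _ h0 (h2.trans hc) ?_⟩
    have := mul_le_mul_of_nonneg_left hc h0.le
    rw [mul_left_comm, mul_inv_cancel₀ h0.ne'] at this
    linarith
  obtain ⟨a, p, hq0, hq1, hmix, hval⟩ := exists_mix_eq_coeffG hlam0 hlam1 l hδ0 hδ1
  refine isLittleO_of_bounds tendsto_inv_nhdsGT_zero (fun η hη => ⟨1, ?_⟩)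
    fun η hη => ⟨1 + (a + 1) / δ, ?_⟩
  · filter_upwards [hup η hη, eventually_mem_Ioo] with ε hε ⟨h0, _⟩
    have h1 : (minObs lam l ε δ : ℝ) ≤ ⌈(coeffG l δ lam + η) * ε⁻¹⌉₊ := by
      exact_mod_cast Nat.sInf_le hε
    have : 0 ≤ (coeffG l δ lam + η) * ε⁻¹ := by positivity
    linarith [Nat.ceil_lt_add_one this]
  · filter_upwards [hup 1 one_pos, eventually_mem_Ioo,
      tendsto_inv_nhdsGT_zero.eventually_ge_atTop (((a : ℝ) + 1) / (1 - δ))]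
      with ε hne ⟨h0, hε1⟩ hsmall
    obtain ⟨-, hm⟩ :=
      Nat.sInf_mem (s := {n | l + 1 ≤ n ∧ upperLimit lam l n δ ≤ ε}) ⟨_, hne⟩
    change upperLimit lam l (minObs lam l ε δ) δ ≤ ε at hm
    set n := minObs lam l ε δ
    set N : ℝ := n + 1 with hN
    have hN0 : 0 < N := by positivity
    have hd : 0 < 1 - δ := by linarith
    have acc0 : acceptProb lam l n 0 = 1 := by
      simp [acceptProb, binomCDF_of_le]
    -- a mixture of zero and one failures shows that `n` is large
    have hlarge : 1 - δ ≤ ε * N := by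
      obtain ⟨c1, -, c3⟩ := acceptProb_bounds hlam0 hlam1 l (n := n) (z := 1) (by omega)
      have hB := binomCDF_nonneg hp0.le hp1.le 1 l
      rw [binomCDF_of_le (by omega : 1 - 1 ≤ l)] at c3
      have hx := mul_nonneg hd.le (hB.trans c1)
      have h := mix_le_of_upperLimit_le hlam0.le hlam1.le hδ0 hm (a := 1) (b := 0) (by omega)
        (by omega) (p := 1 - δ) (by linarith) (by linarith) (by rw [acc0]; linarith)
      have f1 : acceptFailProb lam l n 1 = 1 / N := by
        rw [acceptFailProb, binomCDF_of_le (by omega), ← hN]; simp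
      have f0 : acceptFailProb lam l n 0 = 0 := by simp [acceptFailProb]
      rw [f1, f0, acc0] at h
      have h2 : (1 - δ) * (1 / N) ≤ ε := by
        have := mul_le_mul_of_nonneg_left c3 hd.le
        nlinarith
      rwa [mul_one_div, div_le_iff₀ hN0] at h2
    have haN : a + 1 ≤ n + 1 := by
      have h1 : (a : ℝ) + 1 ≤ N := by
        rw [div_le_iff₀ hd] at hsmall
        have h2 := mul_le_mul_of_nonneg_left hlarge (inv_pos.2 h0).le
        rw [inv_mul_cancel_left₀ h0.ne'] at h2
        linarith
      rw [hN] at h1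
      exact_mod_cast h1
    obtain ⟨a1, a2, -⟩ := acceptProb_bounds hlam0 hlam1 l (n := n) (z := a) (by omega)
    obtain ⟨b1, b2, -⟩ := acceptProb_bounds hlam0 hlam1 l (n := n) (z := a + 1) haN
    have hp' : 0 ≤ 1 - p := by linarith
    have h := mix_le_of_upperLimit_le hlam0.le hlam1.le hδ0 hm (a := a) (b := a + 1) (by omega)
      haN hq0 hq1 (by
        rw [← hmix]
        gcongr)
    have hH : p * acceptProb lam l n a + (1 - p) * acceptProb lam l n (a + 1) ≤
        δ + (a + 1) / N := by
      have a2' : acceptProb lam l n a ≤ binomCDF a l (1 - lam) + (a + 1) / N := by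
        refine a2.trans ?_
        rw [← hN]; gcongr; linarith
      have b2' : acceptProb lam l n (a + 1) ≤ binomCDF (a + 1) l (1 - lam) + (a + 1) / N := by
        rw [← hN] at b2; push_cast at b2; exact b2
      have := mul_le_mul_of_nonneg_left a2' hq0
      have := mul_le_mul_of_nonneg_left b2' hp'
      linarith
    have hF : p * acceptFailProb lam l n a + (1 - p) * acceptFailProb lam l n (a + 1) =
        δ * coeffG l δ lam / N := by
      rw [acceptFailProb, acceptFailProb, ← hN, ← hval, Nat.add_sub_cancel]
      ring
    rw [hF] at h
    have h3 := h.trans (mul_le_mul_of_nonneg_left hH h0.le)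
    rw [div_le_iff₀ hN0] at h3
    have h4 : ε * (δ + (a + 1) / N) * N = ε * (δ * N + (a + 1)) := by field_simp
    rw [h4] at h3
    have h5 : coeffG l δ lam * ε⁻¹ ≤ N + (a + 1) / δ := by
      have : coeffG l δ lam * ε⁻¹ = δ * coeffG l δ lam / (ε * δ) := by field_simp
      rw [this, div_le_iff₀ (by positivity)]
      refine h3.trans_eq ?_
      field_simp
    have := mul_pos hη (inv_pos.2 h0)
    rw [hN] at h5
    linarith

/-- With `t = ε - ε'`, numbers of failures up to `lam * ε' * (n + 1) / (1 - (1 - lam) * ε')`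
have conditional failure probability at most `ε'`, and larger ones are accepted with probability
at most `t * δ` as soon as `n` is large compared to `log δ⁻¹`. -/
theorem upperLimit_le_of_log_le {ε t ρ : ℝ} (hε1 : ε < 1) (ht0 : 0 < t) (htε : t < ε)
    (hρ : lam < ρ) (hρ1 : ρ < 1) :
    ∃ C : ℝ, ∀ (δ : ℝ) (n : ℕ), 0 < δ →
      Real.log δ⁻¹ + C ≤
        lam * (ε - t) * Real.log ρ⁻¹ / (1 - (1 - lam) * (ε - t)) * (n + 1) →
      upperLimit lam l n δ ≤ ε := by
  have hp0 : 0 < 1 - lam := by linarith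
  have hp1 : 1 - lam < 1 := by linarith
  have hρ0 : 0 < ρ := hlam0.trans hρ
  obtain ⟨C, hC0, hC⟩ := exists_binomCDF_le hp0 hp1 l (ρ := ρ) (by linarith) hρ1
  refine ⟨Real.log C - Real.log t + Real.log ρ⁻¹, fun δ n hδ hn => ?_⟩
  set ε' := ε - t with hε'
  have hε'0 : 0 < ε' := by linarith
  have hD : 0 < 1 - (1 - lam) * ε' := by nlinarith
  set N : ℝ := n + 1 with hN
  have hN0 : 0 < N := by positivity
  refine upperLimit_le_of_multiplier (μ := t) (by linarith) hδ ht0.le fun z hz => ?_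
  have hzN : (z : ℝ) ≤ N := by rw [hN]; exact_mod_cast hz
  have hb0 := binomCDF_nonneg hp0.le hp1.le (z - 1) l
  suffices h : acceptFailProb lam l n z ≤ ε' * acceptProb lam l n z + t * δ by
    rw [hε'] at h; linarith
  rcases le_or_gt ((z : ℝ) * (1 - (1 - lam) * ε')) (lam * ε' * N) with hcase | hcase
  · have h1 : acceptFailProb lam l n z ≤ ε' * acceptProb lam l n z := by
      rcases z with _ | z
      · have := mul_nonneg hε'0.le ((binomCDF_nonneg hp0.le hp1.le 0 l).trans
          (acceptProb_bounds hlam0 hlam1 l hz).1)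
        simpa [acceptFailProb] using this
      · rw [acceptFailProb, acceptProb, ← hN, Nat.add_sub_cancel]
        rw [Nat.add_sub_cancel] at hb0
        have hs := mul_binomCDF_le_succ hp0.le hp1.le z l
        rw [sub_sub_cancel] at hs
        set x : ℝ := ((z + 1 : ℕ) : ℝ)
        set b := binomCDF z l (1 - lam)
        have hw : 0 ≤ 1 - x / N := by rw [sub_nonneg, div_le_one hN0]; exact hzN
        have h2 : ε' * (x / N * b + (1 - x / N) * (lam * b)) - x / N * b =
            (lam * ε' * N - x * (1 - (1 - lam) * ε')) * b / N := by
          field_simp; ring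
        have h3 : 0 ≤ (lam * ε' * N - x * (1 - (1 - lam) * ε')) * b / N :=
          div_nonneg (mul_nonneg (by linarith) hb0) hN0.le
        have h4 : ε' * (x / N * b + (1 - x / N) * (lam * b)) ≤
            ε' * (x / N * b + (1 - x / N) * binomCDF (z + 1) l (1 - lam)) := by gcongr
        linarith
    have := mul_pos ht0 hδ
    linarith
  · have hz0 : (0 : ℝ) < z :=
      pos_of_mul_pos_left ((by positivity : 0 ≤ lam * ε' * N).trans_lt hcase) hD.le
    have hz1 : 1 ≤ z := by exact_mod_cast hz0
    have h1 : acceptFailProb lam l n z ≤ binomCDF (z - 1) l (1 - lam) := by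
      rw [acceptFailProb]
      exact mul_le_of_le_one_left hb0 ((div_le_one hN0).2 hzN)
    have hlρ : 0 < Real.log ρ⁻¹ := Real.log_pos ((one_lt_inv₀ hρ0).2 hρ1)
    have h2 : C * ρ ^ (z - 1) ≤ t * δ := by
      rw [← Real.log_le_log_iff (by positivity) (by positivity),
        Real.log_mul hC0.ne' (by positivity), Real.log_mul ht0.ne' hδ.ne', Real.log_pow,
        Nat.cast_sub hz1]
      have h3 : lam * ε' * Real.log ρ⁻¹ / (1 - (1 - lam) * ε') * N ≤ z * Real.log ρ⁻¹ := by
        rw [div_mul_eq_mul_div, div_le_iff₀ hD]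
        have := mul_le_mul_of_nonneg_right hcase.le hlρ.le
        linarith
      have h4 := hn.trans h3
      rw [Real.log_inv, Real.log_inv] at h4
      push_cast
      linarith
    have h3 := mul_nonneg hε'0.le ((binomCDF_nonneg hp0.le hp1.le z l).trans
          (acceptProb_bounds hlam0 hlam1 l hz).1)
    linarith [hC (z - 1)]

/-- A necessary number of observations, obtained from the law with `⌊log δ⁻¹ / log lam⁻¹⌋₊`
failures, which is feasible because `B z ≥ lam ^ z`. The slack `t` is the error in
`B (z + 1) / B z → lam`. -/
theorem log_le_of_upperLimit_le {ε t : ℝ} (hε0 : 0 < ε) (hε1 : ε < 1) (ht0 : 0 < t) :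
    ∃ Z : ℝ, ∀ (δ : ℝ) (n : ℕ), 0 < δ → δ < 1 → Z ≤ Real.log δ⁻¹ → upperLimit lam l n δ ≤ ε →
      (Real.log δ⁻¹ / Real.log lam⁻¹ - 1) * (1 - ε * (1 - (lam + t))) ≤
        ε * (lam + t) * (n + 1) := by
  have hp0 : 0 < 1 - lam := by linarith
  have hp1 : 1 - lam < 1 := by linarith
  have hll : 0 < Real.log lam⁻¹ := Real.log_pos ((one_lt_inv₀ hlam0).2 hlam1)
  obtain ⟨Z, hZ⟩ := eventually_atTop.1 ((tendsto_binomCDF_succ_div hp0 hp1 l).eventually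
    (gt_mem_nhds (show 1 - (1 - lam) < lam + t by linarith)))
  refine ⟨(Z + 1) * Real.log lam⁻¹, fun δ n hδ0 hδ1 hL h => ?_⟩
  have hL0 : 0 < Real.log δ⁻¹ := Real.log_pos ((one_lt_inv₀ hδ0).2 hδ1)
  set z := ⌊Real.log δ⁻¹ / Real.log lam⁻¹⌋₊ with hz
  have hzZ : Z + 1 ≤ z := Nat.le_floor (by
    rw [le_div_iff₀ hll]; push_cast; exact hL)
  have hzle : (z : ℝ) ≤ Real.log δ⁻¹ / Real.log lam⁻¹ := Nat.floor_le (by positivity)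
  have hzlt := Nat.lt_floor_add_one (Real.log δ⁻¹ / Real.log lam⁻¹)
  rw [← hz] at hzlt
  have hpow : δ ≤ lam ^ z := by
    rw [← Real.log_le_log_iff hδ0 (by positivity), Real.log_pow]
    rw [le_div_iff₀ hll, Real.log_inv, Real.log_inv] at hzle
    linarith
  have hB (m : ℕ) := pow_le_binomCDF hp0.le hp1.le m l
  simp only [sub_sub_cancel] at hB
  have key {m : ℕ} (hm : m ≤ n + 1) (hd : δ ≤ acceptProb lam l n m) :
      acceptFailProb lam l n m ≤ ε * acceptProb lam l n m := by
    simpa using mix_le_of_upperLimit_le hlam0.le hlam1.le hδ0 h hm hm zero_le_one le_rfl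
      (by simpa using hd)
  have hN0 : (0 : ℝ) < n + 1 := by positivity
  have hzn : z ≤ n + 1 := by
    by_contra! hlt
    -- the law with failures only has conditional failure probability `1`
    have e1 : acceptProb lam l n (n + 1) = binomCDF n l (1 - lam) := by
      simp [acceptProb, hN0.ne']
    have e2 : acceptFailProb lam l n (n + 1) = binomCDF n l (1 - lam) := by
      simp [acceptFailProb, hN0.ne']
    have h1 : lam ^ z ≤ lam ^ n := pow_le_pow_of_le_one hlam0.le hlam1.le (by omega)
    have h2 := key le_rfl (by rw [e1]; linarith [hB n])
    rw [e1, e2] at h2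
    have h3 := binomCDF_pos hp0 hp1 n l
    nlinarith
  have h1 := key hzn
    (hpow.trans ((hB z).trans (acceptProb_bounds hlam0 hlam1 l hzn).1))
  clear_value z
  obtain ⟨y, rfl⟩ : ∃ y, z = y + 1 := ⟨z - 1, by omega⟩
  have hr := hZ y (by omega)
  have hb := binomCDF_pos hp0 hp1 y l
  rw [div_lt_iff₀ hb] at hr
  rw [acceptFailProb, acceptProb, Nat.add_sub_cancel] at h1
  set N : ℝ := n + 1 with hN
  set x : ℝ := ((y + 1 : ℕ) : ℝ)
  have hxN : x ≤ N := by
    have : ((y + 1 : ℕ) : ℝ) ≤ ((n + 1 : ℕ) : ℝ) := by exact_mod_cast hzn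
    push_cast at this
    simpa [x, hN] using this
  set b := binomCDF y l (1 - lam)
  have hw : 0 ≤ 1 - x / N := by rw [sub_nonneg, div_le_one hN0]; exact hxN
  have h2 : x / N * b ≤ ε * (x / N * b + (1 - x / N) * ((lam + t) * b)) :=
    h1.trans (by gcongr)
  have h3 : ε * (x / N * b + (1 - x / N) * ((lam + t) * b)) - x / N * b =
      (ε * (lam + t) * N - x * (1 - ε * (1 - (lam + t)))) * (b / N) := by
    field_simp; ring
  have h4 : 0 ≤ ε * (lam + t) * N - x * (1 - ε * (1 - (lam + t))) :=
    nonneg_of_mul_nonneg_left (by rw [← h3]; linarith) (by positivity)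
  have h5 : 0 ≤ 1 - ε * (1 - (lam + t)) := by nlinarith [mul_pos hε0 (add_pos hlam0 ht0)]
  have := mul_le_mul_of_nonneg_right
    (show Real.log δ⁻¹ / Real.log lam⁻¹ - 1 ≤ x by linarith) h5
  linarith

theorem minObs_small_delta {ε : ℝ} (hε0 : 0 < ε) (hε1 : ε < 1) :
    (fun δ : ℝ => (minObs lam l ε δ : ℝ) -
        (1 - (1 - lam) * ε) / (lam * ε * Real.log lam⁻¹) * Real.log δ⁻¹)
      =o[𝓝[>] 0] (fun δ : ℝ => Real.log δ⁻¹) := by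
  have hll : 0 < Real.log lam⁻¹ := Real.log_pos ((one_lt_inv₀ hlam0).2 hlam1)
  have hD : 0 < 1 - (1 - lam) * ε := by nlinarith
  set c := (1 - (1 - lam) * ε) / (lam * ε * Real.log lam⁻¹) with hc
  have hc0 : 0 < c := by positivity
  have hup (η : ℝ) (hη : 0 < η) : ∀ᶠ δ : ℝ in 𝓝[>] 0,
      ⌈(c + η) * Real.log δ⁻¹⌉₊ ∈ {n | l + 1 ≤ n ∧ upperLimit lam l n δ ≤ ε} := by
    -- `ε' = ε - t` and `ρ = lam + t` for a small `t`
    obtain ⟨t, htη, ht⟩ : ∃ t, (c + η)⁻¹ <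
        lam * (ε - t) * Real.log (lam + t)⁻¹ / (1 - (1 - lam) * (ε - t)) ∧
        t ∈ Set.Ioo 0 (min ε (1 - lam)) := by
      have hcont : ContinuousAt (fun t : ℝ =>
          lam * (ε - t) * Real.log (lam + t)⁻¹ / (1 - (1 - lam) * (ε - t))) 0 := by
        have h1 : lam + 0 ≠ 0 := by linarith
        have h2 : 1 - (1 - lam) * (ε - 0) ≠ 0 := by rw [sub_zero]; exact hD.ne'
        have h3 := inv_ne_zero h1
        fun_prop (disch := assumption)
      have hlt : (c + η)⁻¹ <
          lam * (ε - 0) * Real.log (lam + 0)⁻¹ / (1 - (1 - lam) * (ε - 0)) := by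
        have : lam * (ε - 0) * Real.log (lam + 0)⁻¹ / (1 - (1 - lam) * (ε - 0)) = c⁻¹ := by
          rw [hc, inv_div, sub_zero, add_zero]
        rw [this]
        exact inv_strictAnti₀ hc0 (by linarith)
      exact ((hcont.continuousWithinAt (s := Set.Ioi 0) |>.eventually (lt_mem_nhds hlt)).and
        (Ioo_mem_nhdsGT (lt_min hε0 (by linarith)))).exists
    obtain ⟨C, hC⟩ := upperLimit_le_of_log_le hlam0 hlam1 l hε1 ht.1
      (ht.2.trans_le (min_le_left _ _)) (show lam < lam + t by linarith [ht.1])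
      (by linarith [ht.2.trans_le (min_le_right _ _)])
    set A := lam * (ε - t) * Real.log (lam + t)⁻¹ / (1 - (1 - lam) * (ε - t))
    have hcη : 0 < c + η := by linarith
    have hA0 : 0 < A := (inv_pos.2 hcη).trans htη
    have hA1 : 0 < A * (c + η) - 1 := by
      rw [inv_lt_iff_one_lt_mul₀ hcη] at htη
      linarith
    filter_upwards [(tendsto_log_inv_nhdsGT_zero.const_mul_atTop hcη).eventually_ge_atTop
      ((l + 1 : ℕ) : ℝ), (tendsto_log_inv_nhdsGT_zero.const_mul_atTop hA1).eventually_ge_atTop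
      C, eventually_mem_Ioo] with δ hl hL ⟨h0, _⟩
    have hn := Nat.le_ceil ((c + η) * Real.log δ⁻¹)
    refine ⟨by exact_mod_cast hl.trans hn, hC δ _ h0 ?_⟩
    have := mul_le_mul_of_nonneg_left hn hA0.le
    linarith
  refine isLittleO_of_bounds tendsto_log_inv_nhdsGT_zero (fun η hη => ⟨1, ?_⟩) fun η hη => ?_
  · filter_upwards [hup η hη, tendsto_log_inv_nhdsGT_zero.eventually_ge_atTop 0] with δ hδ h0
    have h1 : (minObs lam l ε δ : ℝ) ≤ ⌈(c + η) * Real.log δ⁻¹⌉₊ := by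
      exact_mod_cast Nat.sInf_le hδ
    have : 0 ≤ (c + η) * Real.log δ⁻¹ := by positivity
    linarith [Nat.ceil_lt_add_one this]
  · obtain ⟨t, htη, ht⟩ : ∃ t, c - η < (1 - ε * (1 - (lam + t))) /
        (ε * (lam + t) * Real.log lam⁻¹) ∧ t ∈ Set.Ioo (0 : ℝ) 1 := by
      have hcont : ContinuousAt (fun t : ℝ => (1 - ε * (1 - (lam + t))) /
          (ε * (lam + t) * Real.log lam⁻¹)) 0 := by
        have h1 : ε * (lam + 0) * Real.log lam⁻¹ ≠ 0 := by rw [add_zero]; positivity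
        fun_prop (disch := assumption)
      have hlt : c - η < (1 - ε * (1 - (lam + 0))) / (ε * (lam + 0) * Real.log lam⁻¹) := by
        have : (1 - ε * (1 - (lam + 0))) / (ε * (lam + 0) * Real.log lam⁻¹) = c := by
          rw [hc, add_zero, mul_comm ε, mul_comm ε lam]
        rw [this]; linarith
      exact ((hcont.continuousWithinAt (s := Set.Ioi 0) |>.eventually (lt_mem_nhds hlt)).and
        (Ioo_mem_nhdsGT one_pos)).exists
    obtain ⟨Z, hZ⟩ := log_le_of_upperLimit_le hlam0 hlam1 l hε0 hε1 ht.1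
    set d := (1 - ε * (1 - (lam + t))) / (ε * (lam + t) * Real.log lam⁻¹) with hd
    refine ⟨1 + d * Real.log lam⁻¹, ?_⟩
    filter_upwards [hup 1 one_pos, tendsto_log_inv_nhdsGT_zero.eventually_ge_atTop Z,
      tendsto_log_inv_nhdsGT_zero.eventually_ge_atTop 0, eventually_mem_Ioo]
      with δ hne hLZ hL0 ⟨h0, h1⟩
    obtain ⟨-, hm⟩ :=
      Nat.sInf_mem (s := {n | l + 1 ≤ n ∧ upperLimit lam l n δ ≤ ε}) ⟨_, hne⟩
    have h2 := hZ δ _ h0 h1 hLZ hm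
    change _ ≤ ε * (lam + t) * ((minObs lam l ε δ : ℝ) + 1) at h2
    have hlt : 0 < ε * (lam + t) := mul_pos hε0 (by linarith [ht.1])
    have h3 : (Real.log δ⁻¹ / Real.log lam⁻¹ - 1) * (1 - ε * (1 - (lam + t))) =
        ε * (lam + t) * (d * Real.log δ⁻¹ - d * Real.log lam⁻¹) := by
      rw [hd]
      have := hlt.ne'
      have hx : lam + t ≠ 0 := by linarith [ht.1]
      have hb := hll.ne'
      generalize Real.log lam⁻¹ = b at hb ⊢
      generalize Real.log δ⁻¹ = L
      field_simp
    rw [h3] at h2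
    have h4 := le_of_mul_le_mul_left h2 hlt
    have h5 := mul_le_mul_of_nonneg_right htη.le hL0
    linarith

end Randomized

end RandomizedTest


theorem mainTheorem10 (k₀ : ℕ) (lam : ℝ) (hlam0 : 0 < lam) (hlam1 : lam < 1) :
    -- (a) fixed `δ`, and `ε → 0`
    (∀ δ : ℝ, 0 < δ → δ < 1 →
      (fun ε : ℝ => (minObs 0 k₀ ε δ : ℝ) - ((k₀ : ℝ) + 1 - δ) / (δ * ε))
        =o[𝓝[>] 0] (fun ε : ℝ => ε⁻¹) ∧
      (fun ε : ℝ => (minObs lam ⌈(1 - lam) * (k₀ : ℝ)⌉₊ ε δ : ℝ)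
          - coeffG ⌈(1 - lam) * (k₀ : ℝ)⌉₊ δ lam * ε⁻¹)
        =o[𝓝[>] 0] (fun ε : ℝ => ε⁻¹) ∧
      (fun ε : ℝ => (minObsIid k₀ ε δ : ℝ) - poisTime k₀ δ * ε⁻¹)
        =o[𝓝[>] 0] (fun ε : ℝ => ε⁻¹)) ∧
    -- (b) fixed `ε`, and `δ → 0`
    (∀ ε : ℝ, 0 < ε → ε < 1 →
      (fun δ : ℝ => (minObs 0 k₀ ε δ : ℝ) - ((k₀ : ℝ) + 1) / (δ * ε))
        =o[𝓝[>] 0] (fun δ : ℝ => δ⁻¹) ∧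
      (fun δ : ℝ => (minObs lam ⌈(1 - lam) * (k₀ : ℝ)⌉₊ ε δ : ℝ)
          - (1 - (1 - lam) * ε) / (lam * ε * Real.log lam⁻¹) * Real.log δ⁻¹)
        =o[𝓝[>] 0] (fun δ : ℝ => Real.log δ⁻¹) ∧
      (fun δ : ℝ => (minObsIid k₀ ε δ : ℝ) - Real.log δ⁻¹ / Real.log (1 - ε)⁻¹)
        =o[𝓝[>] 0] (fun δ : ℝ => Real.log δ⁻¹) ∧
      -- the deterministic number grows exponentially in the randomized one
      0 < lam * ε * Real.log lam⁻¹ / (1 - (1 - lam) * ε) ∧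
      Tendsto (fun δ : ℝ => Real.log (minObs 0 k₀ ε δ : ℝ)
          / (minObs lam ⌈(1 - lam) * (k₀ : ℝ)⌉₊ ε δ : ℝ))
        (𝓝[>] 0) (𝓝 (lam * ε * Real.log lam⁻¹ / (1 - (1 - lam) * ε)))) := by
  refine ⟨fun δ hδ0 hδ1 => ⟨minObs_zero_small_eps k₀ hδ0 hδ1,
    minObs_small_eps hlam0 hlam1 _ hδ0 hδ1, minObsIid_small_eps k₀ hδ0 hδ1⟩,
    fun ε hε0 hε1 => ?_⟩
  have hN := minObs_small_delta hlam0 hlam1 ⌈(1 - lam) * (k₀ : ℝ)⌉₊ hε0 hε1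
  have hll : 0 < Real.log lam⁻¹ := Real.log_pos ((one_lt_inv₀ hlam0).2 hlam1)
  have hD : 0 < 1 - (1 - lam) * ε := by nlinarith
  refine ⟨minObs_zero_small_delta k₀ hε0 hε1, hN, minObsIid_small_delta k₀ hε0 hε1,
    by positivity, ?_⟩
  set c := (1 - (1 - lam) * ε) / (lam * ε * Real.log lam⁻¹) with hc
  have hc0 : 0 < c := by positivity
  have h1 := hN.tendsto_div_nhds_zero.add_const c
  rw [zero_add] at h1
  have h2 := (tendsto_log_minObs_zero_div k₀ hε0 hε1).div h1 hc0.ne'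
  rw [hc, one_div_div] at h2
  refine h2.congr' ?_
  filter_upwards [tendsto_log_inv_nhdsGT_zero.eventually_gt_atTop 0] with δ hδ
  have e : ((minObs lam ⌈(1 - lam) * (k₀ : ℝ)⌉₊ ε δ : ℝ) - c * Real.log δ⁻¹) /
      Real.log δ⁻¹ + c = minObs lam ⌈(1 - lam) * (k₀ : ℝ)⌉₊ ε δ / Real.log δ⁻¹ := by
    rw [sub_div, mul_div_cancel_right₀ _ hδ.ne', sub_add_cancel]
  rw [Pi.div_apply, ← hc, e, div_div_div_cancel_right₀ hδ.ne']
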